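/- Let $g$ and $\bar g$ be smooth Riemannian metrics on a smooth surface $M^2$ (a smooth $2$-dimensional manifold without boundary). Call $g$ and $\bar g$ geodesically equivalent if they have the same geodesics considered as unparameterized curves, i.e. a curve on an open interval becomes a geodesic of $g$ after a smooth regular change of parameter if and only if it becomes a geodesic of $\bar g$ after a (possibly different) smooth regular change of parameter. Then $g$ and $\bar g$ are geodesically equivalent if and only if the function $$T M^2\to\mathbb R,\qquad (x,\xi)\mapsto \left(\frac{\det(g)}{\det(\bar g)}\right)^{2/3}\bar g(\xi,\xi)\qquad (\xi\in T_xM^2)$$ is an integral of the geodesic flow of $g$, i.e. is constant along $t\mapsto(\gamma(t),\dot\gamma(t))$ for every geodesic $\gamma$ of $g$. Here $\det(g)/\det(\bar g)$ is the quotient at $x$ of the determinants of the matrices $(g_{ij})$ and $(\bar g_{ij})$ computed in one and the same basis of $T_xM^2$; it does not depend on the basis. -/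

import Mathlib

open Set Bundle
open scoped Manifold ContDiff

noncomputable section

namespace GeodesicEquivalence

/-- A smooth Riemannian metric on the smooth `n`-dimensional manifold `M` (without boundary):
a smooth, symmetric, positive definite field of bilinear forms on the tangent spaces. -/
abbrev Metric (n : ℕ) (M : Type*) [TopologicalSpace M] [ChartedSpace (EuclideanSpace ℝ (Fin n)) M]
    [IsManifold (𝓡 n) ∞ M] :=
  ContMDiffRiemannianMetric (𝓡 n) ∞ (EuclideanSpace ℝ (Fin n))
    (fun x : M ↦ TangentSpace (𝓡 n) x)

/-- The `i`-th standard basis vector of `ℝⁿ`. -/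
abbrev stdVec {n : ℕ} (i : Fin n) : EuclideanSpace ℝ (Fin n) := EuclideanSpace.single i 1

section Curves

variable {n : ℕ} {M : Type*} [TopologicalSpace M] [ChartedSpace (EuclideanSpace ℝ (Fin n)) M]
  [IsManifold (𝓡 n) ∞ M]

/-- The Gram matrix `g_ij(y) = g(∂_i, ∂_j)` of the metric in the chart `φ` around `x₀`, as a
function of the coordinates `y` (meaningful on the open target of the chart). The coordinate
field `∂_i` is the image of the `i`-th standard basis vector under the differential of `φ⁻¹`. -/
def gram (g : Metric n M) (x₀ : M) (y : EuclideanSpace ℝ (Fin n)) : Matrix (Fin n) (Fin n) ℝ :=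
  Matrix.of fun i j ↦
    g.inner ((extChartAt (𝓡 n) x₀).symm y)
      (mfderiv (𝓡 n) (𝓡 n) (extChartAt (𝓡 n) x₀).symm y (stdVec i))
      (mfderiv (𝓡 n) (𝓡 n) (extChartAt (𝓡 n) x₀).symm y (stdVec j))

/-- The partial derivative `∂g_ij/∂y_l` in the chart around `x₀`. -/
def gramPartial (g : Metric n M) (x₀ : M) (l i j : Fin n) (y : EuclideanSpace ℝ (Fin n)) : ℝ :=
  fderiv ℝ (fun z ↦ gram g x₀ z i j) y (stdVec l)

/-- The Christoffel symbol `Γ^k_ij = ½ g^{kl} (∂_i g_jl + ∂_j g_il - ∂_l g_ij)` of the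
Levi-Civita connection of `g`, in the chart around `x₀`. -/
def christoffel (g : Metric n M) (x₀ : M) (k i j : Fin n) (y : EuclideanSpace ℝ (Fin n)) : ℝ :=
  (1 / 2 : ℝ) * ∑ l, (gram g x₀ y)⁻¹ k l *
    (gramPartial g x₀ i j l y + gramPartial g x₀ j i l y - gramPartial g x₀ l i j y)

/-- The `k`-th coordinate of the curve `γ` in the chart around `x₀`. -/
def coord (x₀ : M) (γ : ℝ → M) (k : Fin n) (t : ℝ) : ℝ :=
  (extChartAt (𝓡 n) x₀ (γ t)) k

/-- Open intervals of the real line, possibly unbounded. -/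
def IsOpenInterval (J : Set ℝ) : Prop := IsOpen J ∧ J.OrdConnected

/-- The curve `γ`, restricted to the open interval `J`, is a (parameterized) geodesic of `g`:
it is smooth and at every time and in every chart it satisfies
`ü^k + Γ^k_ij(u) u̇^i u̇^j = 0`. -/
def IsGeodesicOn (g : Metric n M) (γ : ℝ → M) (J : Set ℝ) : Prop :=
  ContMDiffOn 𝓘(ℝ, ℝ) (𝓡 n) ∞ γ J ∧
    ∀ t ∈ J, ∀ x₀ : M, γ t ∈ (extChartAt (𝓡 n) x₀).source → ∀ k : Fin n,
      deriv (deriv (coord x₀ γ k)) t +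
        ∑ i, ∑ j, christoffel g x₀ k i j (extChartAt (𝓡 n) x₀ (γ t)) *
          deriv (coord x₀ γ i) t * deriv (coord x₀ γ j) t = 0

/-- `θ` restricts to a smooth diffeomorphism from the open interval `J'` onto `J`. -/
def IsParameterChange (θ : ℝ → ℝ) (J' J : Set ℝ) : Prop :=
  IsOpenInterval J' ∧ ContDiffOn ℝ ∞ θ J' ∧ (∀ s ∈ J', deriv θ s ≠ 0) ∧ BijOn θ J' J

/-- The curve `γ` on `J`, considered as an unparameterized curve, is a geodesic of `g`:
after some change of parameter it satisfies the geodesic equation. -/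
def IsUnparameterizedGeodesicOn (g : Metric n M) (γ : ℝ → M) (J : Set ℝ) : Prop :=
  ∃ (J' : Set ℝ) (θ : ℝ → ℝ), IsParameterChange θ J' J ∧ IsGeodesicOn g (γ ∘ θ) J'

/-- Two metrics are geodesically equivalent if they have the same geodesics, considered as
unparameterized curves. -/
def GeodesicallyEquivalent (g g' : Metric n M) : Prop :=
  ∀ (γ : ℝ → M) (J : Set ℝ), IsOpenInterval J →
    (IsUnparameterizedGeodesicOn g γ J ↔ IsUnparameterizedGeodesicOn g' γ J)

/-- The velocity `(γ(t), γ'(t))` of a curve, as a point of the tangent bundle. -/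
def velocity (γ : ℝ → M) (t : ℝ) : TangentBundle (𝓡 n) M :=
  ⟨γ t, (mfderiv 𝓘(ℝ, ℝ) (𝓡 n) γ t : ℝ →L[ℝ] TangentSpace (𝓡 n) (γ t)) 1⟩

/-- The function `F` on the tangent bundle is an integral of the geodesic flow of `g`: it is
constant along every trajectory `t ↦ (γ(t), γ'(t))`, `γ` a geodesic of `g`, of this (in general
only local) flow. -/
def IsIntegralOfGeodesicFlow (g : Metric n M) (F : TangentBundle (𝓡 n) M → ℝ) : Prop :=
  ∀ (γ : ℝ → M) (J : Set ℝ), IsOpenInterval J → IsGeodesicOn g γ J →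
    ∀ s ∈ J, ∀ t ∈ J, F (velocity γ s) = F (velocity γ t)

/-- The determinant of the Gram matrix of `g` at `x` with respect to the standard basis of the
tangent space at `x`, i.e. the coordinate basis of the preferred chart at `x`. -/
def gramDet (g : Metric n M) (x : M) : ℝ :=
  (Matrix.of fun i j : Fin n ↦
    g.inner x (stdVec i : EuclideanSpace ℝ (Fin n)) (stdVec j : EuclideanSpace ℝ (Fin n))).det

/-- The function `det(g)/det(g')` on the manifold; the quotient does not depend on the basis of
the tangent space in which the two determinants are computed. -/
def detRatio (g g' : Metric n M) (x : M) : ℝ := gramDet g x / gramDet g' x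

end Curves

end GeodesicEquivalence

end

/-! ### The metric in local coordinates as a smooth field of bilinear forms. -/

section ChartForm

open Filter Topology

namespace GeodesicEquivalence

variable {n : ℕ} {M : Type*} [TopologicalSpace M] [ChartedSpace (EuclideanSpace ℝ (Fin n)) M]
  [IsManifold (𝓡 n) ∞ M]

/-! Both properties are equivalent to a third, `IsProjectivelyRelated`. Let D be the difference of
the Levi-Civita connections of `g'` and `g`, and let tr D be the one-form obtained by contracting
it. The condition says D(ξ,ξ) = (2/3) tr D(ξ) ξ. The factor is forced in dimension 2: a tensor φ ⊗
id + id ⊗ φ has trace 3φ.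

Equivalence of geodesics: reparameterization changes the acceleration only by a multiple of the
velocity and a scaling. So if every `g`-geodesic can be reparameterized to a `g'`-geodesic, then
D(ξ,ξ) is parallel to ξ for every ξ, and D has the form above (`spray_sub_eq_of_parallel`).
Conversely, let λ = det g / det g'. Its logarithmic derivative is -2 tr D (`hasDerivAt_detRatio`),
so solving τ' = λ^(1/3) turns `g`-geodesics into `g'`-geodesics.

The integral: along a `g`-geodesic with velocity ξ, the derivative of λ^(2/3) g'(ξ,ξ) is 2 λ^(2/3)
(g'(D(ξ,ξ),ξ) - (2/3) tr D(ξ) g'(ξ,ξ)) (`hasDerivAt_scaledEnergy`). This vanishes if D is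
projective. Conversely, geodesics exist with every initial velocity, so the bracket vanishes
identically. The trace-free part T of D then satisfies g'(T(ξ,ξ),ξ) = 0, which in dimension 2 forces
T = 0 (`tracefree_tensor_eq_zero`). -/

/-- The metric `g` in the chart around `x₀`, as a bilinear form depending on the coordinates. -/
noncomputable def chartForm (g : Metric n M) (x₀ : M) (y : EuclideanSpace ℝ (Fin n)) :
    EuclideanSpace ℝ (Fin n) →L[ℝ] EuclideanSpace ℝ (Fin n) →L[ℝ] ℝ :=
  let A : EuclideanSpace ℝ (Fin n) →L[ℝ] EuclideanSpace ℝ (Fin n) :=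
    mfderiv (𝓡 n) (𝓡 n) (extChartAt (𝓡 n) x₀).symm y
  let B : EuclideanSpace ℝ (Fin n) →L[ℝ] EuclideanSpace ℝ (Fin n) →L[ℝ] ℝ :=
    g.inner ((extChartAt (𝓡 n) x₀).symm y)
  B.bilinearComp A A

lemma chartForm_apply (g : Metric n M) (x₀ : M) (y v w : EuclideanSpace ℝ (Fin n)) :
    chartForm g x₀ y v w = g.inner ((extChartAt (𝓡 n) x₀).symm y)
      (mfderiv (𝓡 n) (𝓡 n) (extChartAt (𝓡 n) x₀).symm y v)
      (mfderiv (𝓡 n) (𝓡 n) (extChartAt (𝓡 n) x₀).symm y w) := rfl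

lemma gram_apply (g : Metric n M) (x₀ : M) (y : EuclideanSpace ℝ (Fin n)) (i j : Fin n) :
    gram g x₀ y i j = chartForm g x₀ y (stdVec i) (stdVec j) := rfl

lemma chartForm_symm (g : Metric n M) (x₀ : M) (y v w : EuclideanSpace ℝ (Fin n)) :
    chartForm g x₀ y v w = chartForm g x₀ y w v := g.symm _ _ _

omit [IsManifold (𝓡 n) ∞ M] in
lemma isOpen_target (x₀ : M) : IsOpen (extChartAt (𝓡 n) x₀).target := isOpen_extChartAt_target x₀

lemma contMDiffAt_symm {x₀ : M} {y : EuclideanSpace ℝ (Fin n)}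
    (hy : y ∈ (extChartAt (𝓡 n) x₀).target) :
    ContMDiffAt (𝓡 n) (𝓡 n) ∞ (extChartAt (𝓡 n) x₀).symm y :=
  (contMDiffOn_extChartAt_symm x₀ y hy).contMDiffAt ((isOpen_target x₀).mem_nhds hy)

lemma mdifferentiableAt_symm {x₀ : M} {y : EuclideanSpace ℝ (Fin n)}
    (hy : y ∈ (extChartAt (𝓡 n) x₀).target) :
    MDifferentiableAt (𝓡 n) (𝓡 n) (extChartAt (𝓡 n) x₀).symm y :=
  (contMDiffAt_symm hy).mdifferentiableAt (by simp)

lemma chartForm_pos (g : Metric n M) {x₀ : M} {y v : EuclideanSpace ℝ (Fin n)}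
    (hy : y ∈ (extChartAt (𝓡 n) x₀).target) (hv : v ≠ 0) : 0 < chartForm g x₀ y v v := by
  rw [chartForm_apply]
  apply g.pos
  have hinv := isInvertible_mfderivWithin_extChartAt_symm (I := 𝓡 n) hy
  rw [show range (𝓡 n) = univ by simp, mfderivWithin_univ] at hinv
  intro h
  exact hv (hinv.injective (h.trans (map_zero _).symm))

/-- It suffices to test on constant vectors. The tangent map of the inverse chart carries them to
smooth fields along that chart, and pairing these with the smooth section `g` is smooth. -/
lemma contDiffOn_chartForm (g : Metric n M) (x₀ : M) :
    ContDiffOn ℝ ∞ (chartForm g x₀) (extChartAt (𝓡 n) x₀).target := by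
  rw [contDiffOn_clm_apply]
  intro v
  rw [contDiffOn_clm_apply]
  intro w
  have hs := contMDiffOn_extChartAt_symm (I := 𝓡 n) (n := ∞) x₀
  have hU : UniqueMDiffOn (𝓡 n) (extChartAt (𝓡 n) x₀).target := (isOpen_target x₀).uniqueMDiffOn
  have hT := hs.contMDiffOn_tangentMapWithin (m := ∞) (by simp) hU
  have key : ∀ v : EuclideanSpace ℝ (Fin n),
      ContMDiffOn (𝓡 n) (𝓡 n).tangent ∞
        (fun y ↦ (TotalSpace.mk' (EuclideanSpace ℝ (Fin n)) ((extChartAt (𝓡 n) x₀).symm y)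
          (mfderiv (𝓡 n) (𝓡 n) (extChartAt (𝓡 n) x₀).symm y v) : TangentBundle (𝓡 n) M))
        (extChartAt (𝓡 n) x₀).target := by
    intro v
    have hc : ContMDiff (𝓡 n) (𝓡 n).tangent ∞
        (fun y ↦ (TotalSpace.mk' (EuclideanSpace ℝ (Fin n)) y v :
          TangentBundle (𝓡 n) (EuclideanSpace ℝ (Fin n)))) := by
      intro y
      refine contMDiffAt_vectorSpace_iff_contDiffAt.2 ?_
      exact contDiffAt_const
    refine (hT.comp hc.contMDiffOn (fun y hy ↦ hy)).congr (fun y hy ↦ ?_)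
    simp only [Function.comp, tangentMapWithin]
    rw [mfderivWithin_of_isOpen (isOpen_target x₀) hy]
  have hg := g.contMDiff.comp_contMDiffOn hs
  have := ContMDiffOn.clm_bundle_apply₂ (F₃ := ℝ) (E₃ := fun _ : M ↦ ℝ) hg (key v) (key w)
  intro y hy
  have h2 := this y hy
  rw [contMDiffWithinAt_totalSpace] at h2
  exact h2.2.contDiffWithinAt

/-- All tangent spaces are the same model space, so the base point can be replaced without
transporting the vectors. -/
lemma inner_congr (g : Metric n M) {x x' : M} (h : x = x') (v w : EuclideanSpace ℝ (Fin n)) :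
    g.inner x (v : EuclideanSpace ℝ (Fin n)) (w : EuclideanSpace ℝ (Fin n)) =
      g.inner x' (v : EuclideanSpace ℝ (Fin n)) (w : EuclideanSpace ℝ (Fin n)) := by
  subst h; rfl

/-- Chain rule for f = φ⁻¹ ∘ (φ ∘ f) near p. The general source `F` covers both uses: inverse
charts, giving the transition law, and curves, giving velocities. -/
lemma inner_mfderiv (g : Metric n M) {F : Type*} [NormedAddCommGroup F] [NormedSpace ℝ F]
    {f : F → M} {p : F} (hf : MDifferentiableAt 𝓘(ℝ, F) (𝓡 n) f p) {x₀ : M}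
    (hp : f p ∈ (extChartAt (𝓡 n) x₀).source) (v w : F) :
    g.inner (f p) (mfderiv 𝓘(ℝ, F) (𝓡 n) f p v) (mfderiv 𝓘(ℝ, F) (𝓡 n) f p w) =
      chartForm g x₀ (extChartAt (𝓡 n) x₀ (f p))
        (fderiv ℝ (extChartAt (𝓡 n) x₀ ∘ f) p v) (fderiv ℝ (extChartAt (𝓡 n) x₀ ∘ f) p w) := by
  have hφ : MDifferentiableAt (𝓡 n) 𝓘(ℝ, EuclideanSpace ℝ (Fin n)) (extChartAt (𝓡 n) x₀) (f p) :=
    mdifferentiableAt_extChartAt (by simpa using hp)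
  have hy : extChartAt (𝓡 n) x₀ (f p) ∈ (extChartAt (𝓡 n) x₀).target :=
    (extChartAt (𝓡 n) x₀).map_source hp
  have heq : (extChartAt (𝓡 n) x₀).symm ∘ (extChartAt (𝓡 n) x₀ ∘ f) =ᶠ[𝓝 p] f := by
    filter_upwards [hf.continuousAt.preimage_mem_nhds
      ((isOpen_extChartAt_source (I := 𝓡 n) x₀).mem_nhds hp)] with q hq
    exact (extChartAt (𝓡 n) x₀).left_inv hq
  have h1 := HasMFDerivAt.comp p (mdifferentiableAt_symm hy).hasMFDerivAt
    (hφ.comp p hf).hasMFDerivAt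
  have h2 := (h1.congr_of_eventuallyEq heq.symm).mfderiv
  have h3 : ∀ v : F, (mfderiv 𝓘(ℝ, F) (𝓡 n) f p v : EuclideanSpace ℝ (Fin n)) =
      mfderiv (𝓡 n) (𝓡 n) (extChartAt (𝓡 n) x₀).symm (extChartAt (𝓡 n) x₀ (f p))
        (fderiv ℝ (extChartAt (𝓡 n) x₀ ∘ f) p v) := by
    intro v
    rw [← mfderiv_eq_fderiv]
    exact congrArg (fun A : F →L[ℝ] EuclideanSpace ℝ (Fin n) ↦ A v) h2
  rw [chartForm_apply]
  refine (inner_congr g ((extChartAt (𝓡 n) x₀).left_inv hp).symm _ _).trans ?_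
  exact congrArg₂ (fun a b : EuclideanSpace ℝ (Fin n) ↦
    (g.inner ((extChartAt (𝓡 n) x₀).symm (extChartAt (𝓡 n) x₀ (f p))) a b : ℝ)) (h3 v) (h3 w)

lemma chartForm_transition (g : Metric n M) {x₀ x₁ : M} {y : EuclideanSpace ℝ (Fin n)}
    (hy : y ∈ (extChartAt (𝓡 n) x₁).target)
    (hy' : (extChartAt (𝓡 n) x₁).symm y ∈ (extChartAt (𝓡 n) x₀).source)
    (v w : EuclideanSpace ℝ (Fin n)) :
    chartForm g x₁ y v w =
      chartForm g x₀ ((extChartAt (𝓡 n) x₀ ∘ (extChartAt (𝓡 n) x₁).symm) y)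
        (fderiv ℝ (extChartAt (𝓡 n) x₀ ∘ (extChartAt (𝓡 n) x₁).symm) y v)
        (fderiv ℝ (extChartAt (𝓡 n) x₀ ∘ (extChartAt (𝓡 n) x₁).symm) y w) :=
  inner_mfderiv g (mdifferentiableAt_symm hy) hy' v w

lemma inner_velocity (g : Metric n M) {γ : ℝ → M} {t : ℝ}
    (hγ : MDifferentiableAt 𝓘(ℝ, ℝ) (𝓡 n) γ t) {x₀ : M}
    (ht : γ t ∈ (extChartAt (𝓡 n) x₀).source) :
    g.inner (velocity γ t).proj (velocity γ t).snd (velocity γ t).snd =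
      chartForm g x₀ (extChartAt (𝓡 n) x₀ (γ t)) (deriv (extChartAt (𝓡 n) x₀ ∘ γ) t)
        (deriv (extChartAt (𝓡 n) x₀ ∘ γ) t) := by
  have h := inner_mfderiv g hγ ht (1 : ℝ) 1
  rw [fderiv_apply_one_eq_deriv] at h
  exact h

lemma contDiffAt_transition {x₀ x₁ : M} {y : EuclideanSpace ℝ (Fin n)}
    (hy : y ∈ (extChartAt (𝓡 n) x₁).target)
    (hy' : (extChartAt (𝓡 n) x₁).symm y ∈ (extChartAt (𝓡 n) x₀).source) :
    ContDiffAt ℝ ∞ (extChartAt (𝓡 n) x₀ ∘ (extChartAt (𝓡 n) x₁).symm) y := by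
  rw [← contMDiffAt_iff_contDiffAt]
  exact (contMDiffAt_extChartAt' (by simpa using hy')).comp y (contMDiffAt_symm hy)

lemma contDiffAt_chart_comp {γ : ℝ → M} {t : ℝ} (hγ : ContMDiffAt 𝓘(ℝ, ℝ) (𝓡 n) ∞ γ t) {x₀ : M}
    (ht : γ t ∈ (extChartAt (𝓡 n) x₀).source) :
    ContDiffAt ℝ ∞ (extChartAt (𝓡 n) x₀ ∘ γ) t := by
  rw [← contMDiffAt_iff_contDiffAt]
  exact (contMDiffAt_extChartAt' (by simpa using ht)).comp t hγ

end GeodesicEquivalence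

end ChartForm

/-! ### Gram determinants in dimension 2 and their quotient. -/

section Determinants

open Filter Topology

namespace GeodesicEquivalence

lemma bilin_apply_fin_two
    (B : EuclideanSpace ℝ (Fin 2) →L[ℝ] EuclideanSpace ℝ (Fin 2) →L[ℝ] ℝ)
    (v w : EuclideanSpace ℝ (Fin 2)) :
    B v w = v 0 * w 0 * B (stdVec 0) (stdVec 0) + v 0 * w 1 * B (stdVec 0) (stdVec 1) +
      v 1 * w 0 * B (stdVec 1) (stdVec 0) + v 1 * w 1 * B (stdVec 1) (stdVec 1) := by
  have h : ∀ v : EuclideanSpace ℝ (Fin 2), v = v 0 • stdVec 0 + v 1 • stdVec 1 := by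
    intro v
    ext i
    fin_cases i <;> simp
  conv_lhs => rw [h v, h w]
  simp only [map_add, map_smul, add_apply, smul_apply,
    smul_eq_mul]
  ring

lemma det_pos_of_bilin_pos
    (B : EuclideanSpace ℝ (Fin 2) →L[ℝ] EuclideanSpace ℝ (Fin 2) →L[ℝ] ℝ)
    (hsymm : ∀ v w, B v w = B w v) (hpos : ∀ v, v ≠ 0 → 0 < B v v) :
    0 < B (stdVec 0) (stdVec 0) * B (stdVec 1) (stdVec 1) -
      B (stdVec 0) (stdVec 1) * B (stdVec 1) (stdVec 0) := by
  have h0 : 0 < B (stdVec 0) (stdVec 0) := hpos _ (by simp)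
  -- This vector is `B`-orthogonal to the first basis vector, and its square is B₀₀ times the
  -- determinant.
  have h1 := hpos !₂[-B (stdVec 0) (stdVec 1), B (stdVec 0) (stdVec 0)] (by
    intro h
    have := congrArg (fun v : EuclideanSpace ℝ (Fin 2) ↦ v 1) h
    simp at this
    exact h0.ne' this)
  rw [bilin_apply_fin_two] at h1
  simp only [Fin.isValue, Matrix.cons_val_zero, Matrix.cons_val_one] at h1
  rw [hsymm (stdVec 1) (stdVec 0)] at *
  refine pos_of_mul_pos_right (a := B (stdVec 0) (stdVec 0)) ?_ h0.le
  linarith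

variable {M : Type*} [TopologicalSpace M] [ChartedSpace (EuclideanSpace ℝ (Fin 2)) M]
  [IsManifold (𝓡 2) ∞ M]

lemma det_gram (g : Metric 2 M) (x₀ : M) (y : EuclideanSpace ℝ (Fin 2)) :
    (gram g x₀ y).det = gram g x₀ y 0 0 * gram g x₀ y 1 1 - gram g x₀ y 0 1 * gram g x₀ y 1 0 :=
  Matrix.det_fin_two _

lemma det_gram_pos (g : Metric 2 M) {x₀ : M} {y : EuclideanSpace ℝ (Fin 2)}
    (hy : y ∈ (extChartAt (𝓡 2) x₀).target) : 0 < (gram g x₀ y).det := by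
  rw [det_gram]
  exact det_pos_of_bilin_pos _ (chartForm_symm g x₀ y) (fun v hv ↦ chartForm_pos g hy hv)

lemma gramDet_pos (g : Metric 2 M) (x : M) : 0 < gramDet g x := by
  rw [gramDet, Matrix.det_fin_two]
  exact det_pos_of_bilin_pos (g.inner x) (g.symm x) (g.pos x)

lemma detRatio_pos (g g' : Metric 2 M) (x : M) : 0 < detRatio g g' x :=
  div_pos (gramDet_pos g x) (gramDet_pos g' x)

/-- Gram determinants in a chart differ from those in the standard bases by a common square. -/
lemma exists_det_gram_eq (x₀ : M) (y : EuclideanSpace ℝ (Fin 2)) :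
    ∃ d : ℝ, ∀ g : Metric 2 M,
      (gram g x₀ y).det = d ^ 2 * gramDet g ((extChartAt (𝓡 2) x₀).symm y) := by
  set a : EuclideanSpace ℝ (Fin 2) :=
    mfderiv (𝓡 2) (𝓡 2) (extChartAt (𝓡 2) x₀).symm y (stdVec 0) with ha
  set b : EuclideanSpace ℝ (Fin 2) :=
    mfderiv (𝓡 2) (𝓡 2) (extChartAt (𝓡 2) x₀).symm y (stdVec 1) with hb
  -- The Jacobian determinant of the inverse chart in the standard bases; it is the same for all
  -- metrics, so it cancels in the quotient.
  refine ⟨a 0 * b 1 - a 1 * b 0, fun g ↦ ?_⟩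
  let B : EuclideanSpace ℝ (Fin 2) →L[ℝ] EuclideanSpace ℝ (Fin 2) →L[ℝ] ℝ :=
    g.inner ((extChartAt (𝓡 2) x₀).symm y)
  have h1 : (gram g x₀ y).det = B a a * B b b - B a b * B b a := det_gram g x₀ y
  have h2 : gramDet g ((extChartAt (𝓡 2) x₀).symm y) = B (stdVec 0) (stdVec 0) *
      B (stdVec 1) (stdVec 1) - B (stdVec 0) (stdVec 1) * B (stdVec 1) (stdVec 0) := by
    rw [gramDet, Matrix.det_fin_two]; rfl
  rw [h1, h2, bilin_apply_fin_two B a a, bilin_apply_fin_two B a b, bilin_apply_fin_two B b a,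
    bilin_apply_fin_two B b b]
  ring

lemma detRatio_symm (g g' : Metric 2 M) {x₀ : M} {y : EuclideanSpace ℝ (Fin 2)}
    (hy : y ∈ (extChartAt (𝓡 2) x₀).target) :
    detRatio g g' ((extChartAt (𝓡 2) x₀).symm y) =
      (gram g x₀ y).det / (gram g' x₀ y).det := by
  obtain ⟨d, hd⟩ := exists_det_gram_eq x₀ y
  have h := (det_gram_pos g hy).ne'
  rw [hd g] at h
  rw [hd g, hd g', detRatio, mul_div_mul_left _ _ (left_ne_zero_of_mul h)]

lemma detRatio_eq (g g' : Metric 2 M) {x₀ x : M} (hx : x ∈ (extChartAt (𝓡 2) x₀).source) :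
    detRatio g g' x = (gram g x₀ (extChartAt (𝓡 2) x₀ x)).det /
      (gram g' x₀ (extChartAt (𝓡 2) x₀ x)).det := by
  rw [← detRatio_symm g g' ((extChartAt (𝓡 2) x₀).map_source hx),
    (extChartAt (𝓡 2) x₀).left_inv hx]

end GeodesicEquivalence

end Determinants

/-! ### Christoffel symbols and the geodesic spray. -/

section Christoffel

open Filter Topology

namespace GeodesicEquivalence

variable {M : Type*} [TopologicalSpace M] [ChartedSpace (EuclideanSpace ℝ (Fin 2)) M]
  [IsManifold (𝓡 2) ∞ M]

lemma clm_apply_fin_two {F : Type*} [NormedAddCommGroup F] [NormedSpace ℝ F]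
    (T : EuclideanSpace ℝ (Fin 2) →L[ℝ] F) (v : EuclideanSpace ℝ (Fin 2)) :
    T v = v 0 • T (stdVec 0) + v 1 • T (stdVec 1) := by
  have h : v = v 0 • stdVec 0 + v 1 • stdVec 1 := by
    ext i
    fin_cases i <;> simp
  conv_lhs => rw [h, map_add, map_smul, map_smul]

lemma differentiableAt_chartForm (g : Metric 2 M) {x₀ : M} {y : EuclideanSpace ℝ (Fin 2)}
    (hy : y ∈ (extChartAt (𝓡 2) x₀).target) : DifferentiableAt ℝ (chartForm g x₀) y :=
  ((contDiffOn_chartForm g x₀).contDiffAt ((isOpen_target x₀).mem_nhds hy)).differentiableAt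
    (by simp)

lemma hasFDerivAt_gram (g : Metric 2 M) {x₀ : M} {y : EuclideanSpace ℝ (Fin 2)}
    (hy : y ∈ (extChartAt (𝓡 2) x₀).target) (i j : Fin 2) :
    HasFDerivAt (fun z ↦ gram g x₀ z i j)
      (((fderiv ℝ (chartForm g x₀) y).flip (stdVec i)).flip (stdVec j)) y := by
  have h := (((differentiableAt_chartForm g hy).hasFDerivAt.clm_apply
    (hasFDerivAt_const (stdVec i) y)).clm_apply (hasFDerivAt_const (stdVec j) y))
  refine h.congr_fderiv ?_
  ext v
  simp

lemma gramPartial_eq (g : Metric 2 M) {x₀ : M} {y : EuclideanSpace ℝ (Fin 2)}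
    (hy : y ∈ (extChartAt (𝓡 2) x₀).target) (l i j : Fin 2) :
    gramPartial g x₀ l i j y = fderiv ℝ (chartForm g x₀) y (stdVec l) (stdVec i) (stdVec j) := by
  rw [gramPartial, (hasFDerivAt_gram g hy i j).fderiv]
  rfl

lemma gram_symm (g : Metric 2 M) (x₀ : M) (y : EuclideanSpace ℝ (Fin 2)) (i j : Fin 2) :
    gram g x₀ y i j = gram g x₀ y j i := chartForm_symm _ _ _ _ _

lemma gramPartial_symm (g : Metric 2 M) (x₀ : M) (y : EuclideanSpace ℝ (Fin 2)) (l i j : Fin 2) :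
    gramPartial g x₀ l i j y = gramPartial g x₀ l j i y := by
  simp only [gramPartial, gram_symm g x₀ _ i j]

lemma christoffel_symm (g : Metric 2 M) (x₀ : M) (y : EuclideanSpace ℝ (Fin 2)) (k i j : Fin 2) :
    christoffel g x₀ k i j y = christoffel g x₀ k j i y := by
  simp only [christoffel, gramPartial_symm g x₀ y _ i j]
  congr 1
  exact Finset.sum_congr rfl fun l _ ↦ by ring

/-- The Christoffel symbols of the first kind. -/
lemma gram_mul_christoffel (g : Metric 2 M) {x₀ : M} {y : EuclideanSpace ℝ (Fin 2)}
    (hy : y ∈ (extChartAt (𝓡 2) x₀).target) (l i j : Fin 2) :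
    gram g x₀ y l 0 * christoffel g x₀ 0 i j y + gram g x₀ y l 1 * christoffel g x₀ 1 i j y =
      (1 / 2 : ℝ) * (gramPartial g x₀ i j l y + gramPartial g x₀ j i l y
        - gramPartial g x₀ l i j y) := by
  have h := Matrix.mul_nonsing_inv (gram g x₀ y) (isUnit_iff_ne_zero.2 (det_gram_pos g hy).ne')
  have h0 := congrFun (congrFun h l) 0
  have h1 := congrFun (congrFun h l) 1
  rw [Matrix.mul_apply, Fin.sum_univ_two] at h0 h1
  simp only [christoffel, Fin.sum_univ_two]
  obtain rfl | rfl : l = 0 ∨ l = 1 := by omega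
  all_goals
    simp only [Matrix.one_apply_eq, ne_eq, one_ne_zero, zero_ne_one, not_false_eq_true,
      Matrix.one_apply_ne] at h0 h1
    linear_combination (1 / 2 : ℝ) * h0 * (gramPartial g x₀ i j 0 y + gramPartial g x₀ j i 0 y
        - gramPartial g x₀ 0 i j y) + (1 / 2 : ℝ) * h1 * (gramPartial g x₀ i j 1 y +
          gramPartial g x₀ j i 1 y - gramPartial g x₀ 1 i j y)

/-- The Levi-Civita connection is metric. -/
lemma gramPartial_eq_christoffel (g : Metric 2 M) {x₀ : M} {y : EuclideanSpace ℝ (Fin 2)}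
    (hy : y ∈ (extChartAt (𝓡 2) x₀).target) (l i j : Fin 2) :
    gramPartial g x₀ l i j y =
      gram g x₀ y j 0 * christoffel g x₀ 0 l i y + gram g x₀ y j 1 * christoffel g x₀ 1 l i y +
      (gram g x₀ y i 0 * christoffel g x₀ 0 l j y +
        gram g x₀ y i 1 * christoffel g x₀ 1 l j y) := by
  rw [gram_mul_christoffel g hy, gram_mul_christoffel g hy, gramPartial_symm g x₀ y l j i]
  ring

/-- The quadratic map `ξ ↦ Γ^k_ij ξ^i ξ^j` given by the Christoffel symbols. -/
noncomputable def spray (g : Metric 2 M) (x₀ : M) (y ξ : EuclideanSpace ℝ (Fin 2)) :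
    EuclideanSpace ℝ (Fin 2) :=
  WithLp.toLp 2 fun k ↦ ∑ i, ∑ j, christoffel g x₀ k i j y * ξ i * ξ j

lemma spray_apply (g : Metric 2 M) (x₀ : M) (y ξ : EuclideanSpace ℝ (Fin 2)) (k : Fin 2) :
    spray g x₀ y ξ k = ∑ i, ∑ j, christoffel g x₀ k i j y * ξ i * ξ j := rfl

lemma spray_smul (g : Metric 2 M) (x₀ : M) (y ξ : EuclideanSpace ℝ (Fin 2)) (c : ℝ) :
    spray g x₀ y (c • ξ) = c ^ 2 • spray g x₀ y ξ := by
  ext k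
  simp only [spray_apply, PiLp.smul_apply, smul_eq_mul, Fin.sum_univ_two]
  ring

/-- The Christoffel symbols of the first kind, contracted with ξ, ξ, w. It removes indices and the
inverse Gram matrix from the change of charts and from the energy computation. -/
lemma chartForm_spray (g : Metric 2 M) {x₀ : M} {y : EuclideanSpace ℝ (Fin 2)}
    (hy : y ∈ (extChartAt (𝓡 2) x₀).target) (ξ w : EuclideanSpace ℝ (Fin 2)) :
    chartForm g x₀ y (spray g x₀ y ξ) w = fderiv ℝ (chartForm g x₀) y ξ ξ w -
      (1 / 2 : ℝ) * fderiv ℝ (chartForm g x₀) y w ξ ξ := by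
  have key : ∀ u v w : EuclideanSpace ℝ (Fin 2), fderiv ℝ (chartForm g x₀) y u v w =
      ∑ l, ∑ i, ∑ j, u l * v i * w j * gramPartial g x₀ l i j y := by
    intro u v w
    have hD := clm_apply_fin_two (fderiv ℝ (chartForm g x₀) y) u
    rw [hD, add_apply, add_apply, smul_apply, smul_apply, smul_apply, smul_apply, smul_eq_mul,
      smul_eq_mul]
    rw [bilin_apply_fin_two, bilin_apply_fin_two (fderiv ℝ (chartForm g x₀) y (stdVec 1))]
    simp only [← gramPartial_eq g hy, Fin.sum_univ_two]
    ring
  rw [key, key, bilin_apply_fin_two]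
  simp only [← gram_apply, spray_apply]
  have h := gram_mul_christoffel g hy
  simp only [Fin.sum_univ_two, gram_symm g x₀ y 1 0]
  have h00 := h 0
  have h01 := h 1
  simp only [gram_symm g x₀ y 1 0] at h01
  linear_combination w 0 * (ξ 0 * ξ 0 * h00 0 0 + ξ 0 * ξ 1 * h00 0 1 + ξ 1 * ξ 0 * h00 1 0 +
    ξ 1 * ξ 1 * h00 1 1) + w 1 * (ξ 0 * ξ 0 * h01 0 0 + ξ 0 * ξ 1 * h01 0 1 +
    ξ 1 * ξ 0 * h01 1 0 + ξ 1 * ξ 1 * h01 1 1)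

end GeodesicEquivalence

end Christoffel

/-! ### Invariance of the geodesic equation under change of chart. -/

section Transition

open Filter Topology

namespace GeodesicEquivalence

lemma two_le_infty : (2 : ℕ∞ω) ≤ ∞ := by
  exact WithTop.coe_le_coe.2 (le_top : (2 : ℕ∞) ≤ ⊤)

set_option synthInstance.maxHeartbeats 200000 in
/-- The derivative of a pulled back bilinear form. -/
lemma fderiv_pullback_bilin {E F : Type*} [NormedAddCommGroup E] [NormedSpace ℝ E]
    [NormedAddCommGroup F] [NormedSpace ℝ F] {B₀ : F → F →L[ℝ] F →L[ℝ] ℝ}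
    {B₁ : E → E →L[ℝ] E →L[ℝ] ℝ} {Φ : E → F} {y : E}
    (h : ∀ᶠ z in 𝓝 y, ∀ a b, B₁ z a b = B₀ (Φ z) (fderiv ℝ Φ z a) (fderiv ℝ Φ z b))
    (hΦ : ContDiffAt ℝ 2 Φ y) (h0 : DifferentiableAt ℝ B₀ (Φ y)) (h1 : DifferentiableAt ℝ B₁ y)
    (c a b : E) :
    fderiv ℝ B₁ y c a b =
      fderiv ℝ B₀ (Φ y) (fderiv ℝ Φ y c) (fderiv ℝ Φ y a) (fderiv ℝ Φ y b) +
      B₀ (Φ y) (fderiv ℝ (fderiv ℝ Φ) y c a) (fderiv ℝ Φ y b) +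
      B₀ (Φ y) (fderiv ℝ Φ y a) (fderiv ℝ (fderiv ℝ Φ) y c b) := by
  have hd : HasFDerivAt Φ (fderiv ℝ Φ y) y := (hΦ.differentiableAt (by simp)).hasFDerivAt
  have hdd : HasFDerivAt (fderiv ℝ Φ) (fderiv ℝ (fderiv ℝ Φ) y) y :=
    ((hΦ.fderiv_right (m := 1) (by norm_num)).differentiableAt (by simp)).hasFDerivAt
  have hl := (h1.hasFDerivAt.clm_apply (hasFDerivAt_const a y)).clm_apply (hasFDerivAt_const b y)
  have hcomp : HasFDerivAt (fun z ↦ B₀ (Φ z)) ((fderiv ℝ B₀ (Φ y)).comp (fderiv ℝ Φ y)) y :=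
    HasFDerivAt.comp (G := F →L[ℝ] F →L[ℝ] ℝ) y h0.hasFDerivAt hd
  have ha := hdd.clm_apply (hasFDerivAt_const a y)
  have hb := hdd.clm_apply (hasFDerivAt_const b y)
  have hr := (hcomp.clm_apply ha).clm_apply hb
  have heq : (fun z ↦ B₁ z a b) =ᶠ[𝓝 y]
      fun z ↦ B₀ (Φ z) (fderiv ℝ Φ z a) (fderiv ℝ Φ z b) := by
    filter_upwards [h] with z hz using hz a b
  have := congrArg (fun T : E →L[ℝ] ℝ ↦ T c) (hl.unique (hr.congr_of_eventuallyEq heq))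
  simp at this
  rw [this]
  ring

variable {M : Type*} [TopologicalSpace M] [ChartedSpace (EuclideanSpace ℝ (Fin 2)) M]
  [IsManifold (𝓡 2) ∞ M]

/-- The geodesic equation does not depend on the chart. -/
lemma add_spray_eq_zero_of_transition (g : Metric 2 M) {x₀ x₁ : M}
    {Φ : EuclideanSpace ℝ (Fin 2) → EuclideanSpace ℝ (Fin 2)}
    (hΦ : Φ = extChartAt (𝓡 2) x₀ ∘ (extChartAt (𝓡 2) x₁).symm)
    {y p a : EuclideanSpace ℝ (Fin 2)} (hy : y ∈ (extChartAt (𝓡 2) x₁).target)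
    (hy' : (extChartAt (𝓡 2) x₁).symm y ∈ (extChartAt (𝓡 2) x₀).source)
    (h : fderiv ℝ (fderiv ℝ Φ) y p p + fderiv ℝ Φ y a + spray g x₀ (Φ y) (fderiv ℝ Φ y p) = 0) :
    a + spray g x₁ y p = 0 := by
  have hΦy : Φ y ∈ (extChartAt (𝓡 2) x₀).target := by
    rw [hΦ]; exact (extChartAt (𝓡 2) x₀).map_source hy'
  have hsm : ContDiffAt ℝ ∞ Φ y := by rw [hΦ]; exact contDiffAt_transition hy hy'
  have hpull : ∀ᶠ z in 𝓝 y, ∀ a b, chartForm g x₁ z a b =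
      chartForm g x₀ (Φ z) (fderiv ℝ Φ z a) (fderiv ℝ Φ z b) := by
    have hc : ContinuousAt (extChartAt (𝓡 2) x₁).symm y := (contMDiffAt_symm hy).continuousAt
    filter_upwards [(isOpen_target x₁).mem_nhds hy, hc.preimage_mem_nhds
      ((isOpen_extChartAt_source (I := 𝓡 2) x₀).mem_nhds hy')] with z hz hz' a b
    rw [hΦ]
    exact chartForm_transition g hz hz' a b
  have hD := fderiv_pullback_bilin hpull (hsm.of_le two_le_infty)
    (differentiableAt_chartForm g hΦy) (differentiableAt_chartForm g hy)
  have hsymm := hsm.isSymmSndFDerivAt (by simpa using two_le_infty)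
  -- By definiteness it suffices to pair with every w. After pulling back, the terms pairing DΦ p
  -- with D²Φ(p, w) cancel by symmetry of D²Φ, and what remains is the equation in the other chart
  -- paired with DΦ w.
  have key : ∀ w, chartForm g x₁ y (a + spray g x₁ y p) w = 0 := by
    intro w
    rw [map_add, add_apply, chartForm_spray g hy, hD, hD, hpull.self_of_nhds, hsymm w p]
    have h2 : spray g x₀ (Φ y) (fderiv ℝ Φ y p) =
        - (fderiv ℝ (fderiv ℝ Φ) y p p) - fderiv ℝ Φ y a := by
      rw [← sub_eq_zero, ← h]; abel
    have h3 := chartForm_spray g hΦy (fderiv ℝ Φ y p) (fderiv ℝ Φ y w)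
    rw [h2, map_sub, map_neg, sub_apply, neg_apply] at h3
    rw [chartForm_symm g x₀ (Φ y) (fderiv ℝ (fderiv ℝ Φ) y p w)]
    linarith
  by_contra hne
  exact (chartForm_pos g hy hne).ne' (key _)

end GeodesicEquivalence

end Transition

/-! ### Geodesic equation in vector form, verified in one chart. -/

section Geodesics

open Filter Topology

namespace GeodesicEquivalence

variable {M : Type*} [TopologicalSpace M] [ChartedSpace (EuclideanSpace ℝ (Fin 2)) M]
  [IsManifold (𝓡 2) ∞ M]

lemma deriv_euclidean_apply {u : ℝ → EuclideanSpace ℝ (Fin 2)} {t : ℝ}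
    (hu : DifferentiableAt ℝ u t) (k : Fin 2) : deriv (fun s ↦ u s k) t = deriv u t k :=
  ((EuclideanSpace.proj (𝕜 := ℝ) k).hasFDerivAt.comp_hasDerivAt t hu.hasDerivAt).deriv

lemma eventually_differentiableAt {E : Type*} [NormedAddCommGroup E] [NormedSpace ℝ E]
    {u : ℝ → E} {t : ℝ} (hu : ContDiffAt ℝ ∞ u t) : ∀ᶠ s in 𝓝 t, DifferentiableAt ℝ u s := by
  filter_upwards [(hu.of_le two_le_infty).eventually (by simp)] with s hs
  exact hs.differentiableAt (by simp)

lemma differentiableAt_deriv {E : Type*} [NormedAddCommGroup E] [NormedSpace ℝ E]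
    {u : ℝ → E} {t : ℝ} (hu : ContDiffAt ℝ ∞ u t) : DifferentiableAt ℝ (deriv u) t :=
  (((hu.of_le two_le_infty).fderiv_right (m := 1) (by norm_num)).differentiableAt
    (by simp)).clm_apply (differentiableAt_const (1 : ℝ))

/-- The geodesic equation in a chart, in vector form. -/
lemma geodesic_equation_iff (g : Metric 2 M) {x₀ : M} {γ : ℝ → M} {t : ℝ}
    (hu : ContDiffAt ℝ ∞ (extChartAt (𝓡 2) x₀ ∘ γ) t) :
    (∀ k : Fin 2, deriv (deriv (coord x₀ γ k)) t +
        ∑ i, ∑ j, christoffel g x₀ k i j (extChartAt (𝓡 2) x₀ (γ t)) *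
          deriv (coord x₀ γ i) t * deriv (coord x₀ γ j) t = 0) ↔
      deriv (deriv (extChartAt (𝓡 2) x₀ ∘ γ)) t +
        spray g x₀ (extChartAt (𝓡 2) x₀ (γ t)) (deriv (extChartAt (𝓡 2) x₀ ∘ γ) t) = 0 := by
  have h1 : ∀ k, deriv (coord x₀ γ k) =ᶠ[𝓝 t]
      fun s ↦ deriv (extChartAt (𝓡 2) x₀ ∘ γ) s k := by
    intro k
    filter_upwards [eventually_differentiableAt hu] with s hs
    exact deriv_euclidean_apply hs k
  have h2 : ∀ k, deriv (deriv (coord x₀ γ k)) t =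
      deriv (deriv (extChartAt (𝓡 2) x₀ ∘ γ)) t k := by
    intro k
    rw [(h1 k).deriv_eq]
    exact deriv_euclidean_apply (differentiableAt_deriv hu) k
  constructor
  · intro h
    ext k
    have := h k
    rw [h2] at this
    simp only [(h1 _).self_of_nhds] at this
    simpa [spray_apply] using this
  · intro h k
    have := congrArg (fun v : EuclideanSpace ℝ (Fin 2) ↦ v k) h
    rw [h2]
    simp only [(h1 _).self_of_nhds]
    simpa [spray_apply] using this

lemma isGeodesicOn_iff (g : Metric 2 M) {γ : ℝ → M} {J : Set ℝ} (hJ : IsOpen J) :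
    IsGeodesicOn g γ J ↔ ContMDiffOn 𝓘(ℝ, ℝ) (𝓡 2) ∞ γ J ∧
      ∀ t ∈ J, ∀ x₀ : M, γ t ∈ (extChartAt (𝓡 2) x₀).source →
        deriv (deriv (extChartAt (𝓡 2) x₀ ∘ γ)) t +
        spray g x₀ (extChartAt (𝓡 2) x₀ (γ t)) (deriv (extChartAt (𝓡 2) x₀ ∘ γ) t) = 0 := by
  refine and_congr_right fun hγ ↦ forall₂_congr fun t ht ↦ forall₂_congr fun x₀ hx ↦ ?_
  exact geodesic_equation_iff g
    (contDiffAt_chart_comp ((hγ t ht).contMDiffAt (hJ.mem_nhds ht)) hx)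

lemma deriv_deriv_comp {E F : Type*} [NormedAddCommGroup E] [NormedSpace ℝ E]
    [NormedAddCommGroup F] [NormedSpace ℝ F] {Φ : E → F} {v : ℝ → E} {t : ℝ}
    (hΦ : ContDiffAt ℝ ∞ Φ (v t)) (hv : ContDiffAt ℝ ∞ v t) :
    deriv (Φ ∘ v) t = fderiv ℝ Φ (v t) (deriv v t) ∧
    deriv (deriv (Φ ∘ v)) t =
      fderiv ℝ (fderiv ℝ Φ) (v t) (deriv v t) (deriv v t) + fderiv ℝ Φ (v t) (deriv (deriv v) t) := by
  have hdd : HasFDerivAt (fderiv ℝ Φ) (fderiv ℝ (fderiv ℝ Φ) (v t)) (v t) :=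
    (((hΦ.of_le two_le_infty).fderiv_right (m := 1) (by norm_num)).differentiableAt
      (by simp)).hasFDerivAt
  have h1 : deriv (Φ ∘ v) =ᶠ[𝓝 t] fun s ↦ fderiv ℝ Φ (v s) (deriv v s) := by
    filter_upwards [eventually_differentiableAt hv, hv.continuousAt.eventually
      ((hΦ.of_le two_le_infty).eventually (by simp))] with s hs hs'
    exact ((hs'.differentiableAt (by simp)).hasFDerivAt.comp_hasDerivAt s hs.hasDerivAt).deriv
  refine ⟨h1.self_of_nhds, ?_⟩
  rw [h1.deriv_eq]
  have h2 : HasDerivAt (fun s ↦ fderiv ℝ Φ (v s)) (fderiv ℝ (fderiv ℝ Φ) (v t) (deriv v t)) t :=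
    HasFDerivAt.comp_hasDerivAt (E := E →L[ℝ] F) t hdd
      (hv.differentiableAt (by simp)).hasDerivAt
  exact (h2.clm_apply (differentiableAt_deriv hv).hasDerivAt).deriv

/-- It suffices to verify the geodesic equation in one chart at each time. -/
lemma isGeodesicOn_of_exists_chart (g : Metric 2 M) {γ : ℝ → M} {J : Set ℝ} (hJ : IsOpen J)
    (hγ : ContMDiffOn 𝓘(ℝ, ℝ) (𝓡 2) ∞ γ J)
    (h : ∀ t ∈ J, ∃ x₀ : M, γ t ∈ (extChartAt (𝓡 2) x₀).source ∧
        deriv (deriv (extChartAt (𝓡 2) x₀ ∘ γ)) t +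
        spray g x₀ (extChartAt (𝓡 2) x₀ (γ t)) (deriv (extChartAt (𝓡 2) x₀ ∘ γ) t) = 0) :
    IsGeodesicOn g γ J := by
  rw [isGeodesicOn_iff g hJ]
  refine ⟨hγ, fun t ht x₁ hx₁ ↦ ?_⟩
  obtain ⟨x₀, hx₀, h0⟩ := h t ht
  have hγt := (hγ t ht).contMDiffAt (hJ.mem_nhds ht)
  have hy : extChartAt (𝓡 2) x₁ (γ t) ∈ (extChartAt (𝓡 2) x₁).target :=
    (extChartAt (𝓡 2) x₁).map_source hx₁
  have hinv := (extChartAt (𝓡 2) x₁).left_inv hx₁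
  have hy' : (extChartAt (𝓡 2) x₁).symm (extChartAt (𝓡 2) x₁ (γ t)) ∈
      (extChartAt (𝓡 2) x₀).source := by rwa [hinv]
  obtain ⟨h1, h2⟩ := deriv_deriv_comp (v := extChartAt (𝓡 2) x₁ ∘ γ)
    (contDiffAt_transition hy hy') (contDiffAt_chart_comp hγt hx₁)
  have heq : (extChartAt (𝓡 2) x₀ ∘ (extChartAt (𝓡 2) x₁).symm) ∘ (extChartAt (𝓡 2) x₁ ∘ γ)
      =ᶠ[𝓝 t] extChartAt (𝓡 2) x₀ ∘ γ := by
    filter_upwards [hγt.continuousAt.preimage_mem_nhds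
      ((isOpen_extChartAt_source (I := 𝓡 2) x₁).mem_nhds hx₁)] with s hs
    simp only [Function.comp]
    rw [(extChartAt (𝓡 2) x₁).left_inv hs]
  rw [heq.deriv_eq] at h1
  rw [heq.deriv.deriv_eq] at h2
  refine add_spray_eq_zero_of_transition g rfl hy hy' ?_
  rw [h1, h2] at h0
  rw [Function.comp_apply, hinv]
  exact h0

end GeodesicEquivalence

end Geodesics

/-! ### Local existence of geodesics. -/

section Existence

open Filter Topology

namespace GeodesicEquivalence

variable {M : Type*} [TopologicalSpace M] [ChartedSpace (EuclideanSpace ℝ (Fin 2)) M]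
  [IsManifold (𝓡 2) ∞ M]

lemma contDiffOn_gram (g : Metric 2 M) (x₀ : M) (i j : Fin 2) :
    ContDiffOn ℝ ∞ (fun y ↦ gram g x₀ y i j) (extChartAt (𝓡 2) x₀).target :=
  ((contDiffOn_chartForm g x₀).clm_apply contDiffOn_const).clm_apply contDiffOn_const

lemma contDiffOn_gramPartial (g : Metric 2 M) (x₀ : M) (l i j : Fin 2) :
    ContDiffOn ℝ ∞ (gramPartial g x₀ l i j) (extChartAt (𝓡 2) x₀).target :=
  ((contDiffOn_gram g x₀ i j).fderiv_of_isOpen (isOpen_target x₀) (by simp)).clm_apply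
    contDiffOn_const

lemma contDiffOn_det_gram (g : Metric 2 M) (x₀ : M) :
    ContDiffOn ℝ ∞ (fun y ↦ (gram g x₀ y).det) (extChartAt (𝓡 2) x₀).target := by
  simp only [det_gram]
  exact ((contDiffOn_gram g x₀ 0 0).mul (contDiffOn_gram g x₀ 1 1)).sub
    ((contDiffOn_gram g x₀ 0 1).mul (contDiffOn_gram g x₀ 1 0))

lemma contDiffOn_inv_gram (g : Metric 2 M) (x₀ : M) (k l : Fin 2) :
    ContDiffOn ℝ ∞ (fun y ↦ (gram g x₀ y)⁻¹ k l) (extChartAt (𝓡 2) x₀).target := by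
  have hdet : ContDiffOn ℝ ∞ (fun y ↦ ((gram g x₀ y).det)⁻¹) (extChartAt (𝓡 2) x₀).target :=
    (contDiffOn_det_gram g x₀).inv fun y hy ↦ (det_gram_pos g hy).ne'
  have hinv : ∀ y, (gram g x₀ y)⁻¹ k l = ((gram g x₀ y).det)⁻¹ *
      (!![gram g x₀ y 1 1, -gram g x₀ y 0 1; -gram g x₀ y 1 0, gram g x₀ y 0 0] k l) := by
    intro y
    rw [Matrix.inv_def, Matrix.adjugate_fin_two, Ring.inverse_eq_inv', Matrix.smul_apply,
      smul_eq_mul]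
  simp only [hinv]
  refine hdet.mul ?_
  fin_cases k <;> fin_cases l
  · exact contDiffOn_gram g x₀ 1 1
  · exact (contDiffOn_gram g x₀ 0 1).neg
  · exact (contDiffOn_gram g x₀ 1 0).neg
  · exact contDiffOn_gram g x₀ 0 0

lemma contDiffOn_christoffel (g : Metric 2 M) (x₀ : M) (k i j : Fin 2) :
    ContDiffOn ℝ ∞ (christoffel g x₀ k i j) (extChartAt (𝓡 2) x₀).target :=
  contDiffOn_const.mul (ContDiffOn.sum fun l _ ↦ (contDiffOn_inv_gram g x₀ k l).mul
    (((contDiffOn_gramPartial g x₀ i j l).add (contDiffOn_gramPartial g x₀ j i l)).sub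
      (contDiffOn_gramPartial g x₀ l i j)))

lemma contDiffOn_spray (g : Metric 2 M) (x₀ : M) :
    ContDiffOn ℝ ∞ (fun q : EuclideanSpace ℝ (Fin 2) × EuclideanSpace ℝ (Fin 2) ↦
      spray g x₀ q.1 q.2) ((extChartAt (𝓡 2) x₀).target ×ˢ univ) := by
  rw [contDiffOn_euclidean]
  intro k
  simp only [spray_apply]
  have hc : ∀ i : Fin 2, ContDiff ℝ ∞
      (fun q : EuclideanSpace ℝ (Fin 2) × EuclideanSpace ℝ (Fin 2) ↦ q.2 i) := fun i ↦
    (EuclideanSpace.proj (𝕜 := ℝ) i).contDiff.comp contDiff_snd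
  exact ContDiffOn.sum fun i _ ↦ ContDiffOn.sum fun j _ ↦
    (((contDiffOn_christoffel g x₀ k i j).comp contDiffOn_fst fun q hq ↦ hq.1).mul
      (hc i).contDiffOn).mul (hc j).contDiffOn

/-- Geodesics with prescribed initial position and velocity exist for short times. -/
lemma exists_geodesic (g : Metric 2 M) {x₀ : M} {y : EuclideanSpace ℝ (Fin 2)}
    (hy : y ∈ (extChartAt (𝓡 2) x₀).target) (ξ : EuclideanSpace ℝ (Fin 2)) :
    ∃ ε > 0, ∃ γ : ℝ → M, IsGeodesicOn g γ (Ioo (-ε) ε) ∧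
      γ 0 = (extChartAt (𝓡 2) x₀).symm y ∧ deriv (extChartAt (𝓡 2) x₀ ∘ γ) 0 = ξ := by
  set S := (extChartAt (𝓡 2) x₀).target ×ˢ (univ : Set (EuclideanSpace ℝ (Fin 2))) with hS
  have hSo : IsOpen S := (isOpen_target x₀).prod isOpen_univ
  -- The geodesic equation as a first-order system for position and velocity.
  let f : EuclideanSpace ℝ (Fin 2) × EuclideanSpace ℝ (Fin 2) →
    EuclideanSpace ℝ (Fin 2) × EuclideanSpace ℝ (Fin 2) := fun q ↦ (q.2, -spray g x₀ q.1 q.2)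
  have hf : ContDiffOn ℝ ∞ f S := contDiffOn_snd.prodMk (contDiffOn_spray g x₀).neg
  have hyS : (y, ξ) ∈ S := ⟨hy, mem_univ _⟩
  obtain ⟨α, hα0, ε, hε, hα⟩ :=
    ((hf.contDiffAt (hSo.mem_nhds hyS)).of_le
      (one_le_two.trans two_le_infty)).exists_forall_mem_closedBall_exists_eq_forall_mem_Ioo_hasDerivAt₀
      (0 : ℝ)
  simp only [zero_sub, zero_add] at hα
  have hcont : ContinuousAt α 0 := (hα 0 ⟨by linarith, hε⟩).continuousAt
  obtain ⟨δ, hδ, hδS⟩ := Metric.eventually_nhds_iff.1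
    (hcont.eventually (hSo.mem_nhds (by rw [hα0]; exact hyS)))
  -- The strict inequality keeps the closed interval [-η, η] inside both the interval of existence
  -- and the times spent in the chart; the smoothness bootstrap below works on a closed interval.
  obtain ⟨η, hη, hηlt⟩ := exists_between (lt_min hε hδ)
  have hη1 : η < ε := hηlt.trans_le (min_le_left _ _)
  have hη2 : η < δ := hηlt.trans_le (min_le_right _ _)
  have hder : ∀ t ∈ Icc (-η) η, HasDerivAt α (f (α t)) t := fun t ht ↦
    hα t ⟨by linarith [ht.1], by linarith [ht.2]⟩
  have hmem : ∀ t ∈ Icc (-η) η, α t ∈ S := fun t ht ↦ hδS (by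
    rw [Real.dist_eq, sub_zero, abs_lt]
    exact ⟨by linarith [ht.1], by linarith [ht.2]⟩)
  have hsm : ContDiffOn ℝ ∞ α (Icc (-η) η) :=
    ODE.contDiffOn_enat_Icc_of_hasDerivWithinAt (n := ⊤) (f := fun _ ↦ f) (u := S)
      (hf.comp contDiffOn_snd fun q hq ↦ hq.2) (fun t ht ↦ (hder t ht).hasDerivWithinAt) hmem
  have hsub : Ioo (-η) η ⊆ Icc (-η) η := Ioo_subset_Icc_self
  have hchart : ∀ t ∈ Icc (-η) η,
      extChartAt (𝓡 2) x₀ ((extChartAt (𝓡 2) x₀).symm (α t).1) = (α t).1 := fun t ht ↦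
    (extChartAt (𝓡 2) x₀).right_inv (hmem t ht).1
  have heq : ∀ t ∈ Ioo (-η) η,
      extChartAt (𝓡 2) x₀ ∘ (fun t ↦ (extChartAt (𝓡 2) x₀).symm (α t).1) =ᶠ[𝓝 t]
        fun s ↦ (α s).1 := fun t ht ↦ by
    filter_upwards [isOpen_Ioo.mem_nhds ht] with s hs using hchart s (hsub hs)
  have hd1 : ∀ t ∈ Ioo (-η) η, deriv (fun s ↦ (α s).1) t = (α t).2 := fun t ht ↦
    ((hasFDerivAt_fst (𝕜 := ℝ) (p := α t)).comp_hasDerivAt t (hder t (hsub ht))).deriv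
  have hd2 : ∀ t ∈ Ioo (-η) η,
      deriv (fun s ↦ (α s).2) t = -spray g x₀ (α t).1 (α t).2 := fun t ht ↦
    ((hasFDerivAt_snd (𝕜 := ℝ) (p := α t)).comp_hasDerivAt t (hder t (hsub ht))).deriv
  have hd : ∀ t ∈ Ioo (-η) η,
      deriv (extChartAt (𝓡 2) x₀ ∘ (fun t ↦ (extChartAt (𝓡 2) x₀).symm (α t).1)) t = (α t).2 :=
    fun t ht ↦ by rw [(heq t ht).deriv_eq, hd1 t ht]
  have h0 : (0 : ℝ) ∈ Ioo (-η) η := ⟨by linarith, hη⟩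
  refine ⟨η, hη, fun t ↦ (extChartAt (𝓡 2) x₀).symm (α t).1, ?_, by simp only [hα0], ?_⟩
  · refine isGeodesicOn_of_exists_chart g isOpen_Ioo ?_ fun t ht ↦ ⟨x₀, ?_, ?_⟩
    · have hu : ContDiffOn ℝ ∞ (fun t ↦ (α t).1) (Ioo (-η) η) :=
        contDiff_fst.comp_contDiffOn (hsm.mono hsub)
      exact (contMDiffOn_extChartAt_symm x₀).comp hu.contMDiffOn
        fun t ht ↦ (hmem t (hsub ht)).1
    · exact (extChartAt (𝓡 2) x₀).map_target (hmem t (hsub ht)).1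
    · have hdd : deriv (extChartAt (𝓡 2) x₀ ∘ (fun t ↦ (extChartAt (𝓡 2) x₀).symm (α t).1))
          =ᶠ[𝓝 t] fun s ↦ (α s).2 := by
        filter_upwards [isOpen_Ioo.mem_nhds ht] with s hs using hd s hs
      rw [hdd.deriv_eq, hd t ht, hd2 t ht, hchart t (hsub ht), neg_add_cancel]
  · rw [hd 0 h0, hα0]

end GeodesicEquivalence

end Existence

/-! ### Algebra of the difference tensor. -/

section Projective

open Filter Topology

namespace GeodesicEquivalence

variable {M : Type*} [TopologicalSpace M] [ChartedSpace (EuclideanSpace ℝ (Fin 2)) M]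
  [IsManifold (𝓡 2) ∞ M]

/-- The difference tensor of the Levi-Civita connections of two metrics. -/
noncomputable def connDiff (g g' : Metric 2 M) (x₀ : M) (y : EuclideanSpace ℝ (Fin 2))
    (k i j : Fin 2) : ℝ :=
  christoffel g' x₀ k i j y - christoffel g x₀ k i j y

/-- The trace of the difference tensor of the Levi-Civita connections of two metrics. -/
noncomputable def connDiffTrace (g g' : Metric 2 M) (x₀ : M)
    (y ξ : EuclideanSpace ℝ (Fin 2)) : ℝ :=
  ∑ i, ξ i * ∑ k, connDiff g g' x₀ y k k i

/-- Two metrics are projectively related if the difference tensor of their Levi-Civita connections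
is the symmetric product of a one-form and the identity; the one-form is then a multiple of the
trace of the difference tensor. -/
def IsProjectivelyRelated (g g' : Metric 2 M) : Prop :=
  ∀ (x₀ : M), ∀ y ∈ (extChartAt (𝓡 2) x₀).target, ∀ ξ : EuclideanSpace ℝ (Fin 2),
    spray g' x₀ y ξ - spray g x₀ y ξ = (2 / 3 * connDiffTrace g g' x₀ y ξ) • ξ

lemma connDiff_symm (g g' : Metric 2 M) (x₀ : M) (y : EuclideanSpace ℝ (Fin 2)) (k i j : Fin 2) :
    connDiff g g' x₀ y k i j = connDiff g g' x₀ y k j i := by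
  rw [connDiff, connDiff, christoffel_symm g', christoffel_symm g]

lemma connDiffTrace_swap (g g' : Metric 2 M) (x₀ : M) (y ξ : EuclideanSpace ℝ (Fin 2)) :
    connDiffTrace g' g x₀ y ξ = -connDiffTrace g g' x₀ y ξ := by
  simp only [connDiffTrace, connDiff, Fin.sum_univ_two]
  ring

lemma IsProjectivelyRelated.symm {g g' : Metric 2 M} (h : IsProjectivelyRelated g g') :
    IsProjectivelyRelated g' g := by
  intro x₀ y hy ξ
  rw [connDiffTrace_swap, mul_neg, neg_smul, ← h x₀ y hy ξ, neg_sub]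

lemma spray_sub_apply (g g' : Metric 2 M) (x₀ : M) (y ξ : EuclideanSpace ℝ (Fin 2)) (k : Fin 2) :
    (spray g' x₀ y ξ - spray g x₀ y ξ) k = connDiff g g' x₀ y k 0 0 * ξ 0 ^ 2 +
      2 * connDiff g g' x₀ y k 0 1 * ξ 0 * ξ 1 + connDiff g g' x₀ y k 1 1 * ξ 1 ^ 2 := by
  rw [PiLp.sub_apply, spray_apply, spray_apply]
  simp only [connDiff, Fin.sum_univ_two, christoffel_symm _ x₀ y k 1 0]
  ring

lemma connDiffTrace_eq (g g' : Metric 2 M) (x₀ : M) (y ξ : EuclideanSpace ℝ (Fin 2)) :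
    connDiffTrace g g' x₀ y ξ = ξ 0 * (connDiff g g' x₀ y 0 0 0 + connDiff g g' x₀ y 1 0 1) +
      ξ 1 * (connDiff g g' x₀ y 0 0 1 + connDiff g g' x₀ y 1 1 1) := by
  simp only [connDiffTrace, Fin.sum_univ_two, connDiff_symm g g' x₀ y 1 1 0]

/-- A difference tensor preserving every direction is projective. -/
lemma spray_sub_eq_of_parallel (g g' : Metric 2 M) {x₀ : M} {y : EuclideanSpace ℝ (Fin 2)}
    (h : ∀ ξ, ∃ c : ℝ, spray g' x₀ y ξ - spray g x₀ y ξ = c • ξ) (ξ : EuclideanSpace ℝ (Fin 2)) :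
    spray g' x₀ y ξ - spray g x₀ y ξ = (2 / 3 * connDiffTrace g g' x₀ y ξ) • ξ := by
  -- Parallelism to (a, b), written as the vanishing of a binary cubic form; four values then kill
  -- its four coefficients.
  have hw : ∀ a b : ℝ,
      (connDiff g g' x₀ y 0 0 0 * a ^ 2 + 2 * connDiff g g' x₀ y 0 0 1 * a * b +
        connDiff g g' x₀ y 0 1 1 * b ^ 2) * b =
      (connDiff g g' x₀ y 1 0 0 * a ^ 2 + 2 * connDiff g g' x₀ y 1 0 1 * a * b +
        connDiff g g' x₀ y 1 1 1 * b ^ 2) * a := by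
    intro a b
    obtain ⟨c, hc⟩ := h !₂[a, b]
    have h0 := congrArg (fun v : EuclideanSpace ℝ (Fin 2) ↦ v 0) hc
    have h1 := congrArg (fun v : EuclideanSpace ℝ (Fin 2) ↦ v 1) hc
    simp only [spray_sub_apply] at h0 h1
    simp at h0 h1
    rw [h0, h1]
    ring
  have e1 := hw 1 0
  have e2 := hw 0 1
  have e3 := hw 1 1
  have e4 := hw 1 (-1)
  have f1 : connDiff g g' x₀ y 1 0 0 = 0 := by linarith
  have f2 : connDiff g g' x₀ y 0 1 1 = 0 := by linarith
  have f3 : connDiff g g' x₀ y 0 0 0 = 2 * connDiff g g' x₀ y 1 0 1 := by linarith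
  have f4 : connDiff g g' x₀ y 1 1 1 = 2 * connDiff g g' x₀ y 0 0 1 := by linarith
  ext k
  rw [spray_sub_apply, PiLp.smul_apply, smul_eq_mul, connDiffTrace_eq, f3, f4]
  obtain rfl | rfl : k = 0 ∨ k = 1 := by omega
  · rw [f2, f3]; ring
  · rw [f1, f4]; ring

/-- A trace-free tensor `T^k_ij` symmetric in `i, j` with `⟨T(ξ, ξ), ξ⟩ = 0` vanishes. -/
lemma tracefree_tensor_eq_zero {a b c p q r s : ℝ} (ha : 0 < a) (hc : 0 < c)
    (hdet : 0 < a * c - b * b) (e1 : a * p + b * r = 0) (e2 : b * s - c * q = 0)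
    (e3 : 2 * a * q - b * p + c * r = 0) (e4 : a * s + b * q - 2 * c * p = 0) :
    p = 0 ∧ q = 0 ∧ r = 0 ∧ s = 0 := by
  -- Here p = T⁰₀₀, q = T⁰₀₁, r = T¹₀₀, s = T⁰₁₁, with T¹₀₁ = -p and T¹₁₁ = -q by trace-freeness;
  -- `e1` to `e4` are the coefficients of the cubic ⟨T(ξ,ξ),ξ⟩. Eliminating r and s leaves a linear
  -- system in p, q whose determinant is, up to sign, (ac - b²)²; Cramer's rule gives the
  -- combinations.
  have hp : (a * c - b * b) ^ 2 * p = 0 := by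
    linear_combination -(a * c + b * b) * (b * e3 - c * e1) + 2 * a * b * (b * e4 - a * e2)
  have hq : (a * c - b * b) ^ 2 * q = 0 := by
    linear_combination (a * c + b * b) * (b * e4 - a * e2) - 2 * b * c * (b * e3 - c * e1)
  obtain rfl := (mul_eq_zero.1 hp).resolve_left (by positivity)
  obtain rfl := (mul_eq_zero.1 hq).resolve_left (by positivity)
  refine ⟨rfl, rfl, ?_, ?_⟩
  · exact (mul_eq_zero.1 (by linarith : c * r = 0)).resolve_left hc.ne'
  · exact (mul_eq_zero.1 (by linarith : a * s = 0)).resolve_left ha.ne'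

/-- Subtracting the projective part from the difference tensor leaves a trace-free T with
g'(T(ξ,ξ),ξ) = 0, hence T = 0. -/
lemma spray_sub_eq_of_chartForm (g g' : Metric 2 M) {x₀ : M} {y : EuclideanSpace ℝ (Fin 2)}
    (hy : y ∈ (extChartAt (𝓡 2) x₀).target)
    (h : ∀ ξ, chartForm g' x₀ y (spray g' x₀ y ξ - spray g x₀ y ξ) ξ =
      2 / 3 * connDiffTrace g g' x₀ y ξ * chartForm g' x₀ y ξ ξ) (ξ : EuclideanSpace ℝ (Fin 2)) :
    spray g' x₀ y ξ - spray g x₀ y ξ = (2 / 3 * connDiffTrace g g' x₀ y ξ) • ξ := by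
  have ha : 0 < gram g' x₀ y 0 0 := chartForm_pos g' hy (by simp)
  have hc : 0 < gram g' x₀ y 1 1 := chartForm_pos g' hy (by simp)
  have hdet := det_gram_pos g' hy
  rw [det_gram, gram_symm g' x₀ y 1 0] at hdet
  have hw : ∀ ξ₀ ξ₁ : ℝ, _ := fun ξ₀ ξ₁ ↦ h !₂[ξ₀, ξ₁]
  simp only [bilin_apply_fin_two, spray_sub_apply, connDiffTrace_eq, ← gram_apply,
    gram_symm g' x₀ y 1 0] at hw
  have e1 := hw 1 0
  have e2 := hw 0 1
  have e3 := hw 1 1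
  have e4 := hw 1 (-1)
  simp only [Matrix.cons_val_zero, Matrix.cons_val_one] at e1 e2 e3 e4
  -- The components of T: with φ one third of the trace, p = D⁰₀₀ - 2φ₀ and q = D⁰₀₁ - φ₁, while
  -- D¹₀₀ and D⁰₁₁ are unaffected.
  have key := tracefree_tensor_eq_zero (b := gram g' x₀ y 0 1)
    (p := (connDiff g g' x₀ y 0 0 0 - 2 * connDiff g g' x₀ y 1 0 1) / 3)
    (q := (2 * connDiff g g' x₀ y 0 0 1 - connDiff g g' x₀ y 1 1 1) / 3)
    (r := connDiff g g' x₀ y 1 0 0) (s := connDiff g g' x₀ y 0 1 1) ha hc hdet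
    (by linarith) (by linarith) (by linarith) (by linarith)
  obtain ⟨hp, hq, hr, hs⟩ := key
  ext k
  rw [spray_sub_apply, PiLp.smul_apply, smul_eq_mul, connDiffTrace_eq]
  obtain rfl | rfl : k = 0 ∨ k = 1 := by omega
  · rw [hs]; linear_combination ξ 0 ^ 2 * hp + 2 * ξ 0 * ξ 1 * hq
  · rw [hr]; linear_combination -ξ 1 ^ 2 * hq - 2 * ξ 0 * ξ 1 * hp

end GeodesicEquivalence

end Projective

/-! ### Derivatives of the determinants and of the energy along curves. -/

section AlongCurves

open Filter Topology

namespace GeodesicEquivalence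

variable {M : Type*} [TopologicalSpace M] [ChartedSpace (EuclideanSpace ℝ (Fin 2)) M]
  [IsManifold (𝓡 2) ∞ M]

lemma hasDerivAt_gram_comp (g : Metric 2 M) {x₀ : M} {u : ℝ → EuclideanSpace ℝ (Fin 2)} {t : ℝ}
    (hu : u t ∈ (extChartAt (𝓡 2) x₀).target) {u' : EuclideanSpace ℝ (Fin 2)}
    (hd : HasDerivAt u u' t) (i j : Fin 2) :
    HasDerivAt (fun s ↦ gram g x₀ (u s) i j)
      (u' 0 * gramPartial g x₀ 0 i j (u t) + u' 1 * gramPartial g x₀ 1 i j (u t)) t := by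
  have h := (hasFDerivAt_gram g hu i j).comp_hasDerivAt t hd
  refine h.congr_deriv ?_
  rw [clm_apply_fin_two, gramPartial_eq g hu, gramPartial_eq g hu]
  rfl

/-- The classical identity ∂ᵢ log det g = 2 Γᵏₖᵢ, from metricity of the connection. -/
lemma hasDerivAt_det_gram_comp (g : Metric 2 M) {x₀ : M} {u : ℝ → EuclideanSpace ℝ (Fin 2)}
    {t : ℝ} (hu : u t ∈ (extChartAt (𝓡 2) x₀).target) {u' : EuclideanSpace ℝ (Fin 2)}
    (hd : HasDerivAt u u' t) :
    HasDerivAt (fun s ↦ (gram g x₀ (u s)).det)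
      (2 * (gram g x₀ (u t)).det * ∑ i, u' i * ∑ k, christoffel g x₀ k k i (u t)) t := by
  have h := ((hasDerivAt_gram_comp g hu hd 0 0).mul (hasDerivAt_gram_comp g hu hd 1 1)).sub
    ((hasDerivAt_gram_comp g hu hd 0 1).mul (hasDerivAt_gram_comp g hu hd 1 0))
  have heq : (fun s ↦ (gram g x₀ (u s)).det) = (fun s ↦ gram g x₀ (u s) 0 0) *
      (fun s ↦ gram g x₀ (u s) 1 1) - (fun s ↦ gram g x₀ (u s) 0 1) *
        (fun s ↦ gram g x₀ (u s) 1 0) := by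
    funext s
    exact det_gram g x₀ (u s)
  rw [heq]
  refine h.congr_deriv ?_
  simp only [det_gram, Fin.sum_univ_two, gramPartial_eq_christoffel g hu, gram_symm g x₀ _ 1 0,
    christoffel_symm g x₀ _ _ 1 0]
  ring

/-- The logarithmic derivative of the quotient of the determinants is minus twice the trace of the
difference tensor. -/
lemma hasDerivAt_detRatio (g g' : Metric 2 M) {γ : ℝ → M} {t : ℝ}
    (hγ : ContMDiffAt 𝓘(ℝ, ℝ) (𝓡 2) ∞ γ t) {x₀ : M} (hx : γ t ∈ (extChartAt (𝓡 2) x₀).source) :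
    HasDerivAt (fun s ↦ detRatio g g' (γ s)) (-2 * detRatio g g' (γ t) *
      connDiffTrace g g' x₀ (extChartAt (𝓡 2) x₀ (γ t)) (deriv (extChartAt (𝓡 2) x₀ ∘ γ) t)) t := by
  have hy : (extChartAt (𝓡 2) x₀ ∘ γ) t ∈ (extChartAt (𝓡 2) x₀).target :=
    (extChartAt (𝓡 2) x₀).map_source hx
  have hd := ((contDiffAt_chart_comp hγ hx).differentiableAt (by simp)).hasDerivAt
  have hpos := (det_gram_pos g' hy).ne'
  have h := (hasDerivAt_det_gram_comp g hy hd).div (hasDerivAt_det_gram_comp g' hy hd) hpos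
  have heq : (fun s ↦ detRatio g g' (γ s)) =ᶠ[𝓝 t]
      fun s ↦ (gram g x₀ ((extChartAt (𝓡 2) x₀ ∘ γ) s)).det /
        (gram g' x₀ ((extChartAt (𝓡 2) x₀ ∘ γ) s)).det := by
    filter_upwards [hγ.continuousAt.preimage_mem_nhds
      ((isOpen_extChartAt_source (I := 𝓡 2) x₀).mem_nhds hx)] with s hs
    exact detRatio_eq g g' hs
  refine (h.congr_of_eventuallyEq heq).congr_deriv ?_
  rw [detRatio_eq g g' hx]
  simp only [Function.comp_apply] at hpos ⊢
  simp only [connDiffTrace, connDiff, Fin.sum_univ_two]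
  field_simp
  ring

/-- Metricity: the derivative of g(u', u') is 2 g(∇u', u'). The curve is arbitrary, since this is
applied to `g'` along geodesics of `g`. -/
lemma hasDerivAt_chartForm_velocity (g : Metric 2 M) {x₀ : M}
    {u : ℝ → EuclideanSpace ℝ (Fin 2)} {t : ℝ} (hu : u t ∈ (extChartAt (𝓡 2) x₀).target)
    (hsm : ContDiffAt ℝ ∞ u t) :
    HasDerivAt (fun s ↦ chartForm g x₀ (u s) (deriv u s) (deriv u s))
      (2 * chartForm g x₀ (u t) (deriv (deriv u) t + spray g x₀ (u t) (deriv u t))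
        (deriv u t)) t := by
  have hd := (hsm.differentiableAt (by simp)).hasDerivAt
  have hdd := (differentiableAt_deriv hsm).hasDerivAt
  have hB : HasDerivAt (fun s ↦ chartForm g x₀ (u s))
      (fderiv ℝ (chartForm g x₀) (u t) (deriv u t)) t :=
    HasFDerivAt.comp_hasDerivAt
      (E := EuclideanSpace ℝ (Fin 2) →L[ℝ] EuclideanSpace ℝ (Fin 2) →L[ℝ] ℝ) t
      (differentiableAt_chartForm g hu).hasFDerivAt hd
  refine ((hB.clm_apply hdd).clm_apply hdd).congr_deriv ?_
  rw [map_add, add_apply, add_apply, chartForm_spray g hu,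
    chartForm_symm g x₀ (u t) (deriv u t) (deriv (deriv u) t)]
  ring

/-- The function `(det g / det g')^(2/3) g'(ξ, ξ)` on the tangent bundle. -/
noncomputable def scaledEnergy (g g' : Metric 2 M) (v : TangentBundle (𝓡 2) M) : ℝ :=
  detRatio g g' v.proj ^ ((2 : ℝ) / 3) * g'.inner v.proj v.snd v.snd

/-- The derivative of `(det g / det g')^(2/3) g'(ξ, ξ)` along the geodesic flow of `g`. -/
lemma hasDerivAt_scaledEnergy (g g' : Metric 2 M) {γ : ℝ → M} {J : Set ℝ} (hJ : IsOpen J)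
    (hγ : IsGeodesicOn g γ J) {t : ℝ} (ht : t ∈ J) {x₀ : M}
    (hx : γ t ∈ (extChartAt (𝓡 2) x₀).source) {y ξ : EuclideanSpace ℝ (Fin 2)}
    (hy : extChartAt (𝓡 2) x₀ (γ t) = y) (hξ : deriv (extChartAt (𝓡 2) x₀ ∘ γ) t = ξ) :
    HasDerivAt (fun s ↦ scaledEnergy g g' (velocity γ s))
      (2 * detRatio g g' (γ t) ^ ((2 : ℝ) / 3) *
        (chartForm g' x₀ y (spray g' x₀ y ξ - spray g x₀ y ξ) ξ -
          2 / 3 * connDiffTrace g g' x₀ y ξ * chartForm g' x₀ y ξ ξ)) t := by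
  obtain ⟨hsm, hgeo⟩ := (isGeodesicOn_iff g hJ).1 hγ
  have hγt := (hsm t ht).contMDiffAt (hJ.mem_nhds ht)
  have hu := contDiffAt_chart_comp hγt hx
  have hyt : (extChartAt (𝓡 2) x₀ ∘ γ) t ∈ (extChartAt (𝓡 2) x₀).target :=
    (extChartAt (𝓡 2) x₀).map_source hx
  have hacc : deriv (deriv (extChartAt (𝓡 2) x₀ ∘ γ)) t = -spray g x₀ y ξ := by
    rw [← hy, ← hξ]
    exact eq_neg_of_add_eq_zero_left (hgeo t ht x₀ hx)
  have hpos := detRatio_pos g g' (γ t)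
  have h1 := (hasDerivAt_detRatio g g' hγt hx).rpow_const (p := (2 : ℝ) / 3) (Or.inl hpos.ne')
  have h2 := hasDerivAt_chartForm_velocity g' hyt hu
  have heq : (fun s ↦ scaledEnergy g g' (velocity γ s)) =ᶠ[𝓝 t]
      fun s ↦ detRatio g g' (γ s) ^ ((2 : ℝ) / 3) *
        chartForm g' x₀ ((extChartAt (𝓡 2) x₀ ∘ γ) s) (deriv (extChartAt (𝓡 2) x₀ ∘ γ) s)
          (deriv (extChartAt (𝓡 2) x₀ ∘ γ) s) := by
    filter_upwards [hγt.continuousAt.preimage_mem_nhds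
      ((isOpen_extChartAt_source (I := 𝓡 2) x₀).mem_nhds hx), hJ.mem_nhds ht] with s hs hsJ
    rw [scaledEnergy, inner_velocity g' (((hsm s hsJ).contMDiffAt (hJ.mem_nhds hsJ)).mdifferentiableAt
      (by simp)) hs]
    rfl
  refine ((h1.mul h2).congr_of_eventuallyEq heq).congr_deriv ?_
  rw [Function.comp_apply, hξ, hacc, hy, neg_add_eq_sub, Real.rpow_sub_one hpos.ne']
  field_simp
  ring

end GeodesicEquivalence

end AlongCurves

/-! ### Changes of parameter. -/

section Reparametrization

open Filter Topology

namespace GeodesicEquivalence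

lemma deriv_deriv_reparam {E : Type*} [NormedAddCommGroup E] [NormedSpace ℝ E] {u : ℝ → E}
    {τ : ℝ → ℝ} {t : ℝ} (hu : ContDiffAt ℝ ∞ u (τ t)) (hτ : ContDiffAt ℝ ∞ τ t) :
    deriv (u ∘ τ) t = deriv τ t • deriv u (τ t) ∧
    deriv (deriv (u ∘ τ)) t =
      deriv (deriv τ) t • deriv u (τ t) + deriv τ t ^ 2 • deriv (deriv u) (τ t) := by
  have h1 : deriv (u ∘ τ) =ᶠ[𝓝 t] fun s ↦ deriv τ s • deriv u (τ s) := by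
    filter_upwards [eventually_differentiableAt hτ, hτ.continuousAt.eventually
      (eventually_differentiableAt hu)] with s hs hs'
    exact (hs'.hasDerivAt.scomp s hs.hasDerivAt).deriv
  refine ⟨h1.self_of_nhds, ?_⟩
  rw [h1.deriv_eq]
  have h2 := (differentiableAt_deriv hu).hasDerivAt.scomp t
    (hτ.differentiableAt (by simp)).hasDerivAt
  refine ((differentiableAt_deriv hτ).hasDerivAt.smul h2).deriv.trans ?_
  rw [smul_smul, ← sq, add_comm]
  rfl

/-- The autonomous equation `τ' = f(τ)` with `f > 0` on an open interval has a solution which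
sweeps out the whole interval. -/
lemma exists_param_of_pos {J : Set ℝ} (hJ : IsOpenInterval J) {f : ℝ → ℝ}
    (hf : ContDiffOn ℝ ∞ f J) (hpos : ∀ t ∈ J, 0 < f t) :
    ∃ (K : Set ℝ) (τ : ℝ → ℝ), IsOpenInterval K ∧ ContDiffOn ℝ ∞ τ K ∧ BijOn τ K J ∧
      ∀ r ∈ K, HasDerivAt τ (f (τ r)) r := by
  obtain ⟨hJo, hJc⟩ := hJ
  obtain rfl | ⟨t₀, ht₀⟩ := J.eq_empty_or_nonempty
  · exact ⟨∅, id, ⟨isOpen_empty, ordConnected_empty⟩, contDiffOn_empty, bijOn_empty _, by simp⟩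
  have hinv : ContDiffOn ℝ ∞ (fun t ↦ (f t)⁻¹) J := hf.inv fun t ht ↦ (hpos t ht).ne'
  -- Separation of variables: this is the new time as a function of the old one, and the solution is
  -- its inverse.
  set s : ℝ → ℝ := fun t ↦ ∫ r in t₀..t, (f r)⁻¹ with hs
  have hder : ∀ t ∈ J, HasDerivAt s (f t)⁻¹ t := fun t ht ↦
    intervalIntegral.integral_hasDerivAt_right
      ((hinv.continuousOn.mono (hJc.uIcc_subset ht₀ ht)).intervalIntegrable)
      (hinv.continuousOn.stronglyMeasurableAtFilter hJo t ht)
      (hinv.continuousOn.continuousAt (hJo.mem_nhds ht))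
  have hsm : ContDiffOn ℝ ∞ s J := by
    rw [contDiffOn_infty_iff_deriv_of_isOpen hJo]
    exact ⟨fun t ht ↦ (hder t ht).differentiableAt.differentiableWithinAt,
      hinv.congr fun t ht ↦ (hder t ht).deriv⟩
  have hmono : StrictMonoOn s J := by
    refine strictMonoOn_of_deriv_pos hJc.convex hsm.continuousOn fun t ht ↦ ?_
    rw [hJo.interior_eq] at ht
    rw [(hder t ht).deriv]
    exact inv_pos.2 (hpos t ht)
  have hKo : IsOpen (s '' J) := by
    rw [isOpen_iff_mem_nhds]
    rintro _ ⟨t, ht, rfl⟩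
    have hst := (hsm.contDiffAt (hJo.mem_nhds ht)).hasStrictDerivAt' (hder t ht) (by simp)
    rw [← hst.map_nhds_eq (inv_pos.2 (hpos t ht)).ne']
    exact image_mem_map (hJo.mem_nhds ht)
  have hbij : BijOn s J (s '' J) := hmono.injOn.bijOn_image
  have hbij' : BijOn (Function.invFunOn s J) (s '' J) J := hbij.symm hbij.invOn_invFunOn.symm
  have hmono' : StrictMonoOn (Function.invFunOn s J) (s '' J) := by
    intro a ha b hb hab
    rw [← hmono.lt_iff_lt (hbij'.mapsTo ha) (hbij'.mapsTo hb),
      hbij.invOn_invFunOn.2 ha, hbij.invOn_invFunOn.2 hb]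
    exact hab
  let e : OpenPartialHomeomorph ℝ ℝ :=
    { toFun := s
      invFun := Function.invFunOn s J
      source := J
      target := s '' J
      map_source' := hbij.mapsTo
      map_target' := hbij'.mapsTo
      left_inv' := hbij.invOn_invFunOn.1
      right_inv' := hbij.invOn_invFunOn.2
      open_source := hJo
      open_target := hKo
      continuousOn_toFun := hsm.continuousOn
      continuousOn_invFun := fun r hr ↦ by
        refine (hmono'.continuousAt_of_image_mem_nhds (hKo.mem_nhds hr) ?_).continuousWithinAt
        rw [hbij'.image_eq]
        exact hJo.mem_nhds (hbij'.mapsTo hr) }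
  refine ⟨s '' J, Function.invFunOn s J,
    ⟨hKo, (hJc.isPreconnected.image s hsm.continuousOn).ordConnected⟩, fun r hr ↦ ?_, hbij',
    fun r hr ↦ ?_⟩
  · have ht := hbij'.mapsTo hr
    exact (e.contDiffAt_symm_deriv (inv_pos.2 (hpos _ ht)).ne' hr (hder _ ht)
      (hsm.contDiffAt (hJo.mem_nhds ht))).contDiffWithinAt
  · have ht := hbij'.mapsTo hr
    have := e.hasDerivAt_symm hr (inv_pos.2 (hpos _ ht)).ne' (hder _ ht)
    rwa [inv_inv] at this

variable {M : Type*} [TopologicalSpace M] [ChartedSpace (EuclideanSpace ℝ (Fin 2)) M]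
  [IsManifold (𝓡 2) ∞ M]

lemma contDiffAt_detRatio_rpow (g g' : Metric 2 M) {γ : ℝ → M} {t : ℝ} (p : ℝ)
    (hγ : ContMDiffAt 𝓘(ℝ, ℝ) (𝓡 2) ∞ γ t) :
    ContDiffAt ℝ ∞ (fun s ↦ detRatio g g' (γ s) ^ p) t := by
  have hx := mem_extChartAt_source (I := 𝓡 2) (γ t)
  have hy := (extChartAt (𝓡 2) (γ t)).map_source hx
  have hu := contDiffAt_chart_comp hγ hx
  have hn := (isOpen_target (γ t)).mem_nhds hy
  have h := (((contDiffOn_det_gram g (γ t)).contDiffAt hn).div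
    ((contDiffOn_det_gram g' (γ t)).contDiffAt hn) (det_gram_pos g' hy).ne').comp t hu
  have heq : (fun s ↦ detRatio g g' (γ s)) =ᶠ[𝓝 t]
      (fun y ↦ (gram g (γ t) y).det / (gram g' (γ t) y).det) ∘
        (extChartAt (𝓡 2) (γ t) ∘ γ) := by
    filter_upwards [hγ.continuousAt.preimage_mem_nhds
      ((isOpen_extChartAt_source (I := 𝓡 2) (γ t)).mem_nhds hx)] with s hs
    exact detRatio_eq g g' hs
  exact (h.congr_of_eventuallyEq heq).rpow_const_of_ne (detRatio_pos g g' (γ t)).ne'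

/-- Geodesics of projectively related metrics differ by a change of parameter. -/
lemma IsProjectivelyRelated.isUnparameterizedGeodesicOn {g g' : Metric 2 M}
    (h : IsProjectivelyRelated g g') {γ : ℝ → M} {J : Set ℝ}
    (hγ : IsUnparameterizedGeodesicOn g γ J) : IsUnparameterizedGeodesicOn g' γ J := by
  obtain ⟨J', θ, ⟨hJ', hθ, hθ', hbij⟩, hgeo⟩ := hγ
  generalize hσ : γ ∘ θ = σ at hgeo
  obtain ⟨hsm, hode⟩ := (isGeodesicOn_iff g hJ'.1).1 hgeo
  have hat : ∀ t ∈ J', ContMDiffAt 𝓘(ℝ, ℝ) (𝓡 2) ∞ σ t := fun t ht ↦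
    (hsm t ht).contMDiffAt (hJ'.1.mem_nhds ht)
  -- For σ ∘ τ to be a `g'`-geodesic, τ'' + (2/3) tr D(σ') τ'² must vanish. With τ' = q(τ) this
  -- reads q' = -(2/3) tr D(σ') q, and λ' = -2 tr D(σ') λ gives the exponent 1/3.
  set q : ℝ → ℝ := fun t ↦ detRatio g g' (σ t) ^ ((1 : ℝ) / 3) with hq
  obtain ⟨K, τ, hK, hτ, hτbij, hτd⟩ := exists_param_of_pos hJ' (f := q)
    (fun t ht ↦ (contDiffAt_detRatio_rpow g g' _ (hat t ht)).contDiffWithinAt)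
    (fun t _ ↦ Real.rpow_pos_of_pos (detRatio_pos g g' _) _)
  refine ⟨K, θ ∘ τ, ⟨hK, hθ.comp hτ hτbij.mapsTo, fun r hr ↦ ?_, hbij.comp hτbij⟩, ?_⟩
  · have ht := hτbij.mapsTo hr
    have hd := ((hθ.contDiffAt (hJ'.1.mem_nhds ht)).differentiableAt (by simp)).hasDerivAt
    rw [(hd.comp r (hτd r hr)).deriv]
    exact mul_ne_zero (hθ' _ ht) (Real.rpow_pos_of_pos (detRatio_pos g g' _) _).ne'
  · rw [← Function.comp_assoc, hσ, isGeodesicOn_iff g' hK.1]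
    refine ⟨hsm.comp hτ.contMDiffOn hτbij.mapsTo, fun r hr x₀ hx ↦ ?_⟩
    have ht := hτbij.mapsTo hr
    have hy : extChartAt (𝓡 2) x₀ (σ (τ r)) ∈ (extChartAt (𝓡 2) x₀).target :=
      (extChartAt (𝓡 2) x₀).map_source hx
    obtain ⟨h1, h2⟩ := deriv_deriv_reparam (contDiffAt_chart_comp (hat _ ht) hx)
      (hτ.contDiffAt (hK.1.mem_nhds hr))
    have hτ1 : deriv τ =ᶠ[𝓝 r] q ∘ τ := by
      filter_upwards [hK.1.mem_nhds hr] with r' hr' using (hτd r' hr').deriv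
    have hpos := detRatio_pos g g' (σ (τ r))
    have hqd := (hasDerivAt_detRatio g g' (hat _ ht) hx).rpow_const (p := (1 : ℝ) / 3)
      (Or.inl hpos.ne')
    have hτ2 := hτ1.deriv_eq.trans (hqd.comp r (hτd r hr)).deriv
    have hacc := eq_neg_of_add_eq_zero_left (hode _ ht x₀ hx)
    have hpr := h x₀ _ hy (deriv (extChartAt (𝓡 2) x₀ ∘ σ) (τ r))
    rw [sub_eq_iff_eq_add] at hpr
    rw [hτ1.self_of_nhds] at h1 h2
    change deriv (deriv ((extChartAt (𝓡 2) x₀ ∘ σ) ∘ τ)) r +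
      spray g' x₀ (extChartAt (𝓡 2) x₀ (σ (τ r))) (deriv ((extChartAt (𝓡 2) x₀ ∘ σ) ∘ τ) r) = 0
    rw [h1, h2, hτ2, hacc, spray_smul, hpr,
      Real.rpow_sub_one hpos.ne']
    have hqr : detRatio g g' (σ (τ r)) ^ ((1 : ℝ) / 3) = q (τ r) := rfl
    rw [hqr, Function.comp_apply]
    match_scalars
    · field_simp
      ring
    · ring

end GeodesicEquivalence

end Reparametrization

/-! ### The equivalences with projective relatedness. -/

section MainTheorem

open Filter Topology

namespace GeodesicEquivalence

variable {M : Type*} [TopologicalSpace M] [ChartedSpace (EuclideanSpace ℝ (Fin 2)) M]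
  [IsManifold (𝓡 2) ∞ M]

lemma IsProjectivelyRelated.geodesicallyEquivalent {g g' : Metric 2 M}
    (h : IsProjectivelyRelated g g') : GeodesicallyEquivalent g g' := fun _ _ _ ↦
  ⟨h.isUnparameterizedGeodesicOn, h.symm.isUnparameterizedGeodesicOn⟩

lemma IsGeodesicOn.isUnparameterizedGeodesicOn {g : Metric 2 M} {γ : ℝ → M} {J : Set ℝ}
    (hJ : IsOpenInterval J) (hγ : IsGeodesicOn g γ J) : IsUnparameterizedGeodesicOn g γ J :=
  ⟨J, id, ⟨hJ, contDiffOn_id, by simp, bijOn_id J⟩, hγ⟩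

lemma isOpenInterval_Ioo (a b : ℝ) : IsOpenInterval (Ioo a b) := ⟨isOpen_Ioo, ordConnected_Ioo⟩

/-- A `g`-geodesic with initial velocity ξ satisfies the `g'`-equation after reparameterization.
Comparing the two equations at a single time shows that the sprays differ at ξ by a multiple of ξ.
-/
lemma GeodesicallyEquivalent.isProjectivelyRelated {g g' : Metric 2 M}
    (h : GeodesicallyEquivalent g g') : IsProjectivelyRelated g g' := by
  intro x₀ y hy
  refine spray_sub_eq_of_parallel g g' fun ξ ↦ ?_
  obtain ⟨ε, hε, γ, hγ, hγ0, hξ⟩ := exists_geodesic g hy ξ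
  have h0 : (0 : ℝ) ∈ Ioo (-ε) ε := ⟨by linarith, hε⟩
  obtain ⟨J', θ, ⟨hJ', hθ, hθ', hbij⟩, hgeo⟩ := (h γ _ (isOpenInterval_Ioo _ _)).1
    (hγ.isUnparameterizedGeodesicOn (isOpenInterval_Ioo _ _))
  obtain ⟨s, hs, hs0⟩ := hbij.surjOn h0
  obtain ⟨hsm, hode⟩ := (isGeodesicOn_iff g isOpen_Ioo).1 hγ
  obtain ⟨-, hode'⟩ := (isGeodesicOn_iff g' hJ'.1).1 hgeo
  have hx : γ 0 ∈ (extChartAt (𝓡 2) x₀).source := by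
    rw [hγ0]; exact (extChartAt (𝓡 2) x₀).map_target hy
  have hxy : extChartAt (𝓡 2) x₀ (γ 0) = y := by
    rw [hγ0]; exact (extChartAt (𝓡 2) x₀).right_inv hy
  have hu := contDiffAt_chart_comp ((hsm 0 h0).contMDiffAt (isOpen_Ioo.mem_nhds h0)) hx
  obtain ⟨h1, h2⟩ := deriv_deriv_reparam (u := extChartAt (𝓡 2) x₀ ∘ γ) (by rwa [hs0])
    (hθ.contDiffAt (hJ'.1.mem_nhds hs))
  have hacc := hode 0 h0 x₀ hx
  have hacc' := hode' s hs x₀ (by rwa [Function.comp_apply, hs0])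
  rw [← Function.comp_assoc, h1, h2, Function.comp_apply, hs0, hxy, hξ, spray_smul,
    eq_neg_of_add_eq_zero_left hacc, hxy, hξ] at hacc'
  have hne := hθ' s hs
  -- From θ'' ξ + θ'² (spray of `g'` - spray of `g`) = 0.
  refine ⟨-(deriv (deriv θ) s / deriv θ s ^ 2), ?_⟩
  have hsub : deriv θ s ^ 2 • (spray g' x₀ y ξ - spray g x₀ y ξ) = -(deriv (deriv θ) s • ξ) := by
    rw [← sub_eq_zero, ← hacc']
    module
  rw [← inv_smul_smul₀ (pow_ne_zero 2 hne) (spray g' x₀ y ξ - spray g x₀ y ξ), hsub]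
  module

lemma IsProjectivelyRelated.isIntegralOfGeodesicFlow {g g' : Metric 2 M}
    (h : IsProjectivelyRelated g g') : IsIntegralOfGeodesicFlow g (scaledEnergy g g') := by
  intro γ J hJ hγ s hs t ht
  have hd : ∀ t ∈ J, HasDerivAt (fun s ↦ scaledEnergy g g' (velocity γ s)) 0 t := by
    intro t ht
    have hx := mem_extChartAt_source (I := 𝓡 2) (γ t)
    refine (hasDerivAt_scaledEnergy g g' hJ.1 hγ ht hx rfl rfl).congr_deriv ?_
    rw [h _ _ ((extChartAt (𝓡 2) (γ t)).map_source hx), map_smul, smul_apply, smul_eq_mul,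
      sub_self, mul_zero]
  exact hJ.1.is_const_of_deriv_eq_zero hJ.2.isPreconnected
    (fun t ht ↦ (hd t ht).differentiableAt.differentiableWithinAt)
    (fun t ht ↦ (hd t ht).deriv) hs ht

/-- Only the derivative at time 0 is needed: with every initial velocity allowed, its vanishing is a
pointwise identity in ξ. -/
lemma isProjectivelyRelated_of_isIntegral {g g' : Metric 2 M}
    (h : IsIntegralOfGeodesicFlow g (scaledEnergy g g')) : IsProjectivelyRelated g g' := by
  intro x₀ y hy
  refine spray_sub_eq_of_chartForm g g' hy fun ξ ↦ ?_
  obtain ⟨ε, hε, γ, hγ, hγ0, hξ⟩ := exists_geodesic g hy ξ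
  have h0 : (0 : ℝ) ∈ Ioo (-ε) ε := ⟨by linarith, hε⟩
  have hx : γ 0 ∈ (extChartAt (𝓡 2) x₀).source := by
    rw [hγ0]; exact (extChartAt (𝓡 2) x₀).map_target hy
  have hxy : extChartAt (𝓡 2) x₀ (γ 0) = y := by
    rw [hγ0]; exact (extChartAt (𝓡 2) x₀).right_inv hy
  have hd := hasDerivAt_scaledEnergy g g' isOpen_Ioo hγ h0 hx hxy hξ
  have hconst : (fun s ↦ scaledEnergy g g' (velocity γ s)) =ᶠ[𝓝 0]
      fun _ ↦ scaledEnergy g g' (velocity γ 0) := by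
    filter_upwards [isOpen_Ioo.mem_nhds h0] with s hs
    exact h γ _ (isOpenInterval_Ioo _ _) hγ s hs 0 h0
  have hzero := hd.unique ((hasDerivAt_const (0 : ℝ) _).congr_of_eventuallyEq hconst)
  have hpos := Real.rpow_pos_of_pos (detRatio_pos g g' (γ 0)) ((2 : ℝ) / 3)
  exact sub_eq_zero.1 ((mul_eq_zero.1 hzero).resolve_left (by positivity))

end GeodesicEquivalence

end MainTheorem

/-- Two smooth Riemannian metrics `g`, `g'` on a surface are geodesically equivalent if and only if
`(det g / det g')^(2/3) g'(ξ, ξ)` is an integral of the geodesic flow of `g`. -/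
theorem corollary2 {M : Type*} [TopologicalSpace M]
    [ChartedSpace (EuclideanSpace ℝ (Fin 2)) M] [IsManifold (𝓡 2) ∞ M]
    (g g' : GeodesicEquivalence.Metric 2 M) :
    GeodesicEquivalence.GeodesicallyEquivalent g g' ↔
      GeodesicEquivalence.IsIntegralOfGeodesicFlow g
        (fun v : TangentBundle (𝓡 2) M ↦
          (GeodesicEquivalence.detRatio g g' v.proj) ^ ((2 : ℝ) / 3) *
            g'.inner v.proj v.snd v.snd) :=
  ⟨fun h ↦ h.isProjectivelyRelated.isIntegralOfGeodesicFlow,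
    fun h ↦ (GeodesicEquivalence.isProjectivelyRelated_of_isIntegral h).geodesicallyEquivalent⟩
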